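/- Let $0<q<1$. For complex $x$ write $(x;q)_n=\prod_{k=0}^{n-1}(1-xq^k)$, $(x;q)_\infty=\prod_{k=0}^{\infty}(1-xq^k)$ and $(x_1,\dots,x_m;q)_n=(x_1;q)_n\cdots(x_m;q)_n$ for $n\in\mathbb{N}\cup\{\infty\}$. For $-1\le x\le 1$ put $$h(x;a|q)=\prod_{k=0}^\infty(1-2q^kax+q^{2k}a^2),\qquad h(x;a_1,\dots,a_m|q)=\prod_{j=1}^m h(x;a_j|q),$$ so that $h(\cos\theta;a|q)=(ae^{i\theta},ae^{-i\theta};q)_\infty$, and let $${}_4\phi_3\left({a_1,a_2,a_3,a_4\atop b_1,b_2,b_3};q,z\right)=\sum_{n=0}^\infty\frac{(a_1,a_2,a_3,a_4;q)_n z^n}{(q,b_1,b_2,b_3;q)_n}.$$ **Theorem.** Let $a,b,c,d,r$ be complex numbers with $\max\{|a|,|b|,|c|,|d|,|r|\}<1$, let $\alpha=a^2bcdr/q$ with $\alpha\ne1$, and let $\lambda$ be a complex number with $\lambda\neq0$ and $\lambda\ne q^{-k}$ for all integers $k\ge0$. Let $\sqrt\lambda$ and $\sqrt{q\alpha}$ be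 any choices of the square roots. Then the ${}_4\phi_3$ series below converges absolutely for every real $\theta$, the integrand is integrable on $[0,\pi]$, the series on the right-hand side converges absolutely, and $$\int_{0}^{\pi} \frac{h(\cos 2\theta; 1|q)}{h(\cos \theta; a, b, c, d, r|q)}\;{}_4\phi_3\left({ae^{i\theta}, ae^{-i\theta}, \sqrt{\lambda},-\sqrt{\lambda}\atop\sqrt{q\alpha}, -\sqrt{q\alpha}, \lambda}; q, bcdr\right) d\theta$$ $$=\frac{2\pi (abcd, abcr, abdr, acdr; q)_\infty}{(q, ab, ac, ad, ar, bc, bd, br, cd, cr, dr, a^2bcdr; q)_\infty}\sum_{n=0}^\infty \frac{(1-\alpha q^{4n})(\alpha, ab, ac, ad, ar; q)_{2n}\,(q, q\alpha/\lambda; q^2)_n}{(1-\alpha)(q, abcd, abcr, abdr, acdr; q)_{2n}\,(q\alpha, q\lambda; q^2)_n}(bcdr)^{2n}\lambda^n q^{2n^2-n}.$$ -/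

import Mathlib

open scoped Real

namespace QBeta

noncomputable section

/-- The finite `q`-shifted factorial `(a; q)_n = ∏_{k=0}^{n-1} (1 - a q^k)`. -/
def qPoch (a q : ℂ) (n : ℕ) : ℂ := ∏ k ∈ Finset.range n, (1 - a * q ^ k)

/-- The infinite `q`-shifted factorial `(a; q)_∞ = ∏_{k=0}^∞ (1 - a q^k)`
(the product converges for `|q| < 1`, see `multipliable_qPochInf`). -/
def qPochInf (a q : ℂ) : ℂ := ∏' k : ℕ, (1 - a * q ^ k)

/-- `(a₁, …, aₘ; q)_n = (a₁; q)_n ⋯ (aₘ; q)_n`. -/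
def qPochs (as : List ℂ) (q : ℂ) (n : ℕ) : ℂ := (as.map fun a => qPoch a q n).prod

/-- `(a₁, …, aₘ; q)_∞ = (a₁; q)_∞ ⋯ (aₘ; q)_∞`. -/
def qPochInfs (as : List ℂ) (q : ℂ) : ℂ := (as.map fun a => qPochInf a q).prod

/-- The `n`-th term `(a₁, …, a_{r+1}; q)_n z^n / (q, b₁, …, b_r; q)_n` of the basic hypergeometric
series with upper parameters `as` and lower parameters `bs`. -/
def phiTerm (as bs : List ℂ) (q z : ℂ) (n : ℕ) : ℂ :=
  qPochs as q n * z ^ n / qPochs (q :: bs) q n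

/-- The basic hypergeometric series `_{r+1}φ_r(a₁, …, a_{r+1}; b₁, …, b_r; q, z)`. -/
def phi (as bs : List ℂ) (q z : ℂ) : ℂ := ∑' n : ℕ, phiTerm as bs q z n

/-- `h(x; a|q) = ∏_{k=0}^∞ (1 - 2 q^k a x + q^{2k} a²)`; for `x = cos θ` this is
`(a e^{iθ}, a e^{-iθ}; q)_∞`, see `h_cos`. -/
def h (x : ℝ) (a q : ℂ) : ℂ :=
  ∏' k : ℕ, (1 - 2 * q ^ k * a * (x : ℂ) + q ^ (2 * k) * a ^ 2)

/-- `h(x; a₁, …, aₘ|q) = h(x; a₁|q) ⋯ h(x; aₘ|q)`. -/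
def hs (x : ℝ) (as : List ℂ) (q : ℂ) : ℂ := (as.map fun a => h x a q).prod

theorem multipliable_qPochInf (a : ℂ) {q : ℂ} (hq : ‖q‖ < 1) :
    Multipliable fun k : ℕ => (1 - a * q ^ k) := by
  simp only [sub_eq_add_neg]
  refine multipliable_one_add_of_summable ?_
  simp only [norm_neg, norm_mul, norm_pow]
  exact (summable_geometric_of_lt_one (norm_nonneg _) hq).mul_left _

theorem h_cos (θ : ℝ) (a : ℂ) {q : ℂ} (hq : ‖q‖ < 1) :
    h (Real.cos θ) a q =
      qPochInf (a * Complex.exp (Complex.I * θ)) q *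
        qPochInf (a * Complex.exp (-(Complex.I * θ))) q := by
  unfold h qPochInf
  rw [← (multipliable_qPochInf _ hq).tprod_mul (multipliable_qPochInf _ hq)]
  refine tprod_congr fun k => ?_
  have h1 : Complex.exp (Complex.I * θ) * Complex.exp (-(Complex.I * θ)) = 1 := by
    rw [← Complex.exp_add]; simp
  have h2 : 2 * (Real.cos θ : ℂ) =
      Complex.exp (Complex.I * θ) + Complex.exp (-(Complex.I * θ)) := by
    rw [Complex.ofReal_cos, Complex.two_cos, mul_comm Complex.I]
    simp
  linear_combination (-(q ^ k * a)) * h2 - (a ^ 2 * q ^ (2 * k)) * h1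

end

end QBeta

/-! The proof combines Bailey's lemma with Rahman's five-parameter extension of the Askey–Wilson
integral.

The `₄φ₃` has the form `∑ (ρ₁, ρ₂; q)_n z^n β_n` with `ρ₁ = a e^{iθ}`, `ρ₂ = a e^{-iθ}`, `z = bcdr`,
where `β_n` belongs to a Bailey pair relative to `α` with vanishing odd entries. Since `qα = ρ₁ρ₂z`,
interchanging sums and applying the `q`-Gauss sum (`tsum_gaussTerm`, `tsum_bailey`) rewrites it as a
sum over the even entries `α_{2j}`. Multiplied by the weight, the `j`-th term is a constant times
Rahman's integrand with `a` replaced by `a q^{2j}` (`hasSum_integrand`). Dominated convergence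
permits termwise integration, and `rahmanIntegral_eq` evaluates each term.

The Bailey pair relation (`sum_pairTerm`) is proved by creative telescoping in `n`.

For Rahman's integral, a rational identity compares the kernels at `t₁` and `q t₁` modulo a function
antisymmetric under `z ↦ 1/(qz)`. Cauchy's theorem on `1 ≤ |z| ≤ 1/q` makes that function's circle
mean zero. Iteration sends `t₁` to `0`; by symmetry the integral divided by its expected value does
not depend on the parameters. The constant is read off at `(√q, -√q, q, -q, 0)`, where the kernel is
a trigonometric polynomial. -/

namespace QBeta

open Filter Topology


/-! ### Shifted factorials: algebra, convergence and bounds -/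

section Pochhammer

variable {q : ℂ}

@[simp] theorem qPoch_zero (a q : ℂ) : qPoch a q 0 = 1 := by simp [qPoch]

theorem qPoch_succ (a q : ℂ) (n : ℕ) : qPoch a q (n + 1) = qPoch a q n * (1 - a * q ^ n) := by
  simp [qPoch, Finset.prod_range_succ]

theorem qPoch_add (a q : ℂ) (m n : ℕ) :
    qPoch a q (m + n) = qPoch a q m * qPoch (a * q ^ m) q n := by
  simp only [qPoch, Finset.prod_range_add]
  congr 1
  exact Finset.prod_congr rfl fun k _ => by ring

theorem qPoch_succ' (a q : ℂ) (n : ℕ) : qPoch a q (n + 1) = (1 - a) * qPoch (a * q) q n := by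
  rw [add_comm, qPoch_add]; simp [qPoch]

@[simp] theorem qPoch_zero_left (q : ℂ) (n : ℕ) : qPoch 0 q n = 1 := by simp [qPoch]

/-- Pairing the even and the odd factors. -/
theorem qPoch_two_mul (a q : ℂ) (n : ℕ) :
    qPoch a q (2 * n) = qPoch a (q ^ 2) n * qPoch (a * q) (q ^ 2) n := by
  induction n with
  | zero => simp
  | succ n ih =>
    rw [show 2 * (n + 1) = 2 * n + 1 + 1 by ring, qPoch_succ, qPoch_succ, ih, qPoch_succ,
      qPoch_succ]
    ring

theorem qPoch_mul_neg (a q : ℂ) (n : ℕ) :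
    qPoch a q n * qPoch (-a) q n = qPoch (a ^ 2) (q ^ 2) n := by
  simp only [qPoch, ← Finset.prod_mul_distrib]
  exact Finset.prod_congr rfl fun k _ => by ring

theorem qPoch_ne_zero {a q : ℂ} (h : ∀ k : ℕ, a * q ^ k ≠ 1) (n : ℕ) : qPoch a q n ≠ 0 :=
  Finset.prod_ne_zero_iff.2 fun k _ => sub_ne_zero.2 (h k).symm

theorem mul_pow_ne_one {a : ℂ} (hq : ‖q‖ < 1) (ha : ‖a‖ < 1) (k : ℕ) : a * q ^ k ≠ 1 := by
  intro h
  have h1 : ‖a * q ^ k‖ < 1 := by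
    rw [norm_mul, norm_pow]
    exact (mul_le_of_le_one_right (norm_nonneg _)
      (pow_le_one₀ (norm_nonneg _) hq.le)).trans_lt ha
  rw [h, norm_one] at h1
  exact lt_irrefl _ h1

theorem qPoch_ne_zero_of_norm_lt {a : ℂ} (hq : ‖q‖ < 1) (ha : ‖a‖ < 1) (n : ℕ) :
    qPoch a q n ≠ 0 :=
  qPoch_ne_zero (mul_pow_ne_one hq ha) n

theorem tendsto_qPoch (hq : ‖q‖ < 1) (a : ℂ) :
    Tendsto (qPoch a q) atTop (𝓝 (qPochInf a q)) :=
  (multipliable_qPochInf a hq).hasProd.tendsto_prod_nat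

theorem qPochInf_eq_qPoch_mul (hq : ‖q‖ < 1) (a : ℂ) (n : ℕ) :
    qPochInf a q = qPoch a q n * qPochInf (a * q ^ n) q := by
  refine tendsto_nhds_unique ((tendsto_add_atTop_iff_nat n).2 (tendsto_qPoch hq a)) ?_
  simp_rw [add_comm _ n, qPoch_add]
  exact (tendsto_qPoch hq _).const_mul _

theorem qPochInf_eq_mul (hq : ‖q‖ < 1) (a : ℂ) :
    qPochInf a q = (1 - a) * qPochInf (q * a) q := by
  rw [qPochInf_eq_qPoch_mul hq a 1]; simp [qPoch, mul_comm]

@[simp] theorem qPochInf_zero_left (q : ℂ) : qPochInf 0 q = 1 := by simp [qPochInf]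

theorem qPochInf_ne_zero {a : ℂ} (hq : ‖q‖ < 1) (h : ∀ k : ℕ, a * q ^ k ≠ 1) :
    qPochInf a q ≠ 0 := by
  have := tprod_one_add_ne_zero_of_summable (f := fun k : ℕ => -(a * q ^ k))
    (fun k => by rw [← sub_eq_add_neg]; exact sub_ne_zero.2 (h k).symm) (by
      simp only [norm_neg, norm_mul, norm_pow]
      exact (summable_geometric_of_lt_one (norm_nonneg _) hq).mul_left _)
  simpa only [qPochInf, sub_eq_add_neg] using this

theorem qPochInf_ne_zero_of_norm_lt {a : ℂ} (hq : ‖q‖ < 1) (ha : ‖a‖ < 1) :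
    qPochInf a q ≠ 0 :=
  qPochInf_ne_zero hq (mul_pow_ne_one hq ha)

/-- The product converges uniformly on the ball of radius `‖a‖ + 1`, so holomorphy passes from the
partial products to the limit. -/
theorem differentiable_qPochInf (hq : ‖q‖ < 1) : Differentiable ℂ fun a => qPochInf a q := by
  intro a
  have h := Summable.hasProdLocallyUniformlyOn_nat_one_add (f := fun (k : ℕ) (x : ℂ) => -(x * q ^ k))
    (K := Metric.ball (0 : ℂ) (‖a‖ + 1)) Metric.isOpen_ball
    ((summable_geometric_of_lt_one (norm_nonneg _) hq).mul_left (‖a‖ + 1))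
    (.of_forall fun k x hx => by
      rw [norm_neg, norm_mul, norm_pow]
      exact mul_le_mul_of_nonneg_right (by simpa using (Metric.mem_ball.1 hx).le) (by positivity))
    (fun k => by fun_prop)
  have hd := h.differentiableOn (.of_forall fun s => by
    simpa [Finset.prod_fn] using DifferentiableOn.finsetProd (fun _ _ => by fun_prop))
    Metric.isOpen_ball
  have := hd.differentiableAt (Metric.isOpen_ball.mem_nhds (x := a) (by simp))
  simpa only [qPochInf, sub_eq_add_neg] using this

theorem continuous_qPochInf (hq : ‖q‖ < 1) : Continuous fun a => qPochInf a q :=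
  (differentiable_qPochInf hq).continuous

theorem exists_norm_qPoch_le (hq : ‖q‖ < 1) :
    ∃ M : ℝ, 0 < M ∧ ∀ a : ℂ, ‖a‖ ≤ 1 → ∀ n, ‖qPoch a q n‖ ≤ M := by
  refine ⟨Real.exp (∑' k : ℕ, ‖q‖ ^ k), Real.exp_pos _, fun a ha n => ?_⟩
  have hs := summable_geometric_of_lt_one (norm_nonneg _) hq
  calc ‖qPoch a q n‖ = ∏ k ∈ Finset.range n, ‖1 - a * q ^ k‖ := by rw [qPoch, norm_prod]
    _ ≤ ∏ k ∈ Finset.range n, (1 + ‖q‖ ^ k) := by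
        refine Finset.prod_le_prod (fun _ _ => norm_nonneg _) fun k _ => ?_
        refine (norm_sub_le _ _).trans ?_
        rw [norm_one, norm_mul, norm_pow]
        gcongr
        exact mul_le_of_le_one_left (by positivity) ha
    _ ≤ Real.exp (∑ k ∈ Finset.range n, ‖q‖ ^ k) :=
        Real.prod_one_add_le_exp_sum _ fun _ => by positivity
    _ ≤ _ := Real.exp_le_exp.2 (hs.sum_le_tsum _ fun _ _ => by positivity)

theorem exists_norm_qPochInf_le (hq : ‖q‖ < 1) :
    ∃ M : ℝ, 0 < M ∧ ∀ a : ℂ, ‖a‖ ≤ 1 → ‖qPochInf a q‖ ≤ M := by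
  obtain ⟨M, hM, h⟩ := exists_norm_qPoch_le hq
  exact ⟨M, hM, fun a ha => le_of_tendsto (tendsto_qPoch hq a).norm (.of_forall (h a ha))⟩

theorem exists_norm_qPoch_le_of_fixed (hq : ‖q‖ < 1) (a : ℂ) :
    ∃ M : ℝ, 0 < M ∧ ∀ n, ‖qPoch a q n‖ ≤ M := by
  obtain ⟨M, hM⟩ := (tendsto_qPoch hq a).norm.bddAbove_range
  exact ⟨max M 1, by positivity, fun n => (hM ⟨n, rfl⟩).trans (le_max_left _ _)⟩

theorem exists_norm_inv_qPoch_le (hq : ‖q‖ < 1) {a : ℂ} (h : ∀ k : ℕ, a * q ^ k ≠ 1) :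
    ∃ M : ℝ, 0 < M ∧ ∀ n, ‖(qPoch a q n)⁻¹‖ ≤ M := by
  obtain ⟨M, hM⟩ := ((tendsto_qPoch hq a).inv₀ (qPochInf_ne_zero hq h)).norm.bddAbove_range
  exact ⟨max M 1, by positivity, fun n => (hM ⟨n, rfl⟩).trans (le_max_left _ _)⟩

end Pochhammer


/-! ### The `q`-Gauss sum -/

section Gauss

variable {q : ℂ}

/-- The `n`-th term of the series `₂φ₁(A, B; ABz; q, z)` summed by the `q`-Gauss formula. -/
noncomputable def gaussTerm (q A B z : ℂ) (n : ℕ) : ℂ :=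
  qPoch A q n * qPoch B q n * z ^ n / (qPoch q q n * qPoch (A * B * z) q n)

theorem norm_mul_pow_lt_one {z : ℂ} (hq : ‖q‖ < 1) (hz : ‖z‖ < 1) (m : ℕ) :
    ‖z * q ^ m‖ < 1 := by
  rw [norm_mul, norm_pow]
  exact (mul_le_of_le_one_right (norm_nonneg _) (pow_le_one₀ (norm_nonneg _) hq.le)).trans_lt hz

/-- Uniformity in `m` comes from `(ABzq^m; q)_n = (ABz; q)_{m+n} / (ABz; q)_m`. It supplies the
dominating series for the limit `z q^m → 0`. -/
theorem exists_norm_gaussTerm_le (hq : ‖q‖ < 1) {A B z : ℂ} (hABz : ‖A * B * z‖ < 1) :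
    ∃ C : ℝ, ∀ m n : ℕ, ‖gaussTerm q A B (z * q ^ m) n‖ ≤ C * ‖z‖ ^ n := by
  obtain ⟨M₁, h₁, H₁⟩ := exists_norm_qPoch_le_of_fixed hq A
  obtain ⟨M₂, h₂, H₂⟩ := exists_norm_qPoch_le_of_fixed hq B
  obtain ⟨M₃, h₃, H₃⟩ := exists_norm_inv_qPoch_le hq (mul_pow_ne_one hq hq)
  obtain ⟨M₄, h₄, H₄⟩ := exists_norm_inv_qPoch_le hq (mul_pow_ne_one hq hABz)
  obtain ⟨M₅, h₅, H₅⟩ := exists_norm_qPoch_le_of_fixed hq (A * B * z)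
  refine ⟨M₁ * M₂ * (M₃ * (M₅ * M₄)), fun m n => ?_⟩
  have h0 : (qPoch (A * B * (z * q ^ m)) q n)⁻¹ =
      qPoch (A * B * z) q m * (qPoch (A * B * z) q (m + n))⁻¹ := by
    rw [qPoch_add, mul_inv, mul_inv_cancel_left₀ (qPoch_ne_zero_of_norm_lt hq hABz m),
      mul_assoc (A * B)]
  rw [gaussTerm, div_eq_mul_inv, mul_inv, h0]
  simp only [norm_mul, norm_pow]
  have hz : (‖z‖ * ‖q‖ ^ m) ^ n ≤ ‖z‖ ^ n := by
    gcongr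
    exact mul_le_of_le_one_right (norm_nonneg _) (pow_le_one₀ (norm_nonneg _) hq.le)
  calc _ ≤ M₁ * M₂ * ‖z‖ ^ n * (M₃ * (M₅ * M₄)) := by
        gcongr
        exacts [H₁ n, H₂ n, H₃ n, H₅ m, H₄ _]
    _ = _ := by ring

theorem summable_gaussTerm (hq : ‖q‖ < 1) {A B z : ℂ} (hz : ‖z‖ < 1) (hABz : ‖A * B * z‖ < 1) :
    Summable (gaussTerm q A B z) := by
  obtain ⟨C, hC⟩ := exists_norm_gaussTerm_le hq hABz
  exact .of_norm_bounded ((summable_geometric_of_lt_one (norm_nonneg _) hz).mul_left C)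
    fun n => by simpa using hC 0 n

/-- A telescoping certificate for `z ↦ zq`: the companion vanishes at `n = 0` because of `1 - q^n`
and at infinity because the terms do, so the two sums are proportional. -/
theorem gaussTerm_sub (hq : ‖q‖ < 1) {A B z : ℂ} (hz : ‖z‖ < 1) (hABz : ‖A * B * z‖ < 1)
    (n : ℕ) :
    gaussTerm q A B z n - (1 - A * z) * (1 - B * z) / ((1 - A * B * z) * (1 - z)) *
        gaussTerm q A B (z * q) n =
      -(1 - q ^ (n + 1)) / (1 - z) * gaussTerm q A B z (n + 1) -
        -(1 - q ^ n) / (1 - z) * gaussTerm q A B z n := by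
  have h1 : 1 - z ≠ 0 := sub_ne_zero.2 (by simpa using (mul_pow_ne_one hq hz 0).symm)
  have h2 : 1 - A * B * z ≠ 0 := sub_ne_zero.2 (by simpa using (mul_pow_ne_one hq hABz 0).symm)
  have h3 : 1 - A * B * z * q ^ n ≠ 0 := sub_ne_zero.2 (mul_pow_ne_one hq hABz n).symm
  have h4 : 1 - q * q ^ n ≠ 0 := sub_ne_zero.2 (mul_pow_ne_one hq hq n).symm
  have h5 := qPoch_ne_zero_of_norm_lt hq hq n
  have h6 := qPoch_ne_zero_of_norm_lt hq hABz n
  have h7 : qPoch (A * B * (z * q)) q n =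
      qPoch (A * B * z) q n * (1 - A * B * z * q ^ n) / (1 - A * B * z) := by
    rw [eq_div_iff h2, ← qPoch_succ, qPoch_succ', mul_comm, mul_assoc (A * B)]
  simp only [gaussTerm, h7, qPoch_succ, mul_pow, pow_succ]
  rw [mul_comm (q ^ n) q]
  generalize q * q ^ n = w at *
  generalize q ^ n = x at *
  field_simp
  ring

theorem tsum_gaussTerm_step (hq : ‖q‖ < 1) {A B z : ℂ} (hz : ‖z‖ < 1) (hABz : ‖A * B * z‖ < 1) :
    ∑' n, gaussTerm q A B z n = (1 - A * z) * (1 - B * z) / ((1 - A * B * z) * (1 - z)) *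
        ∑' n, gaussTerm q A B (z * q) n := by
  have hs := summable_gaussTerm hq hz hABz
  have hs' : Summable (gaussTerm q A B (z * q)) := by
    apply summable_gaussTerm hq
    · simpa using norm_mul_pow_lt_one hq hz 1
    · simpa [mul_assoc] using norm_mul_pow_lt_one hq hABz 1
  rw [← sub_eq_zero, ← tsum_mul_left, ← (hs.tsum_sub (hs'.mul_left _))]
  have hd : Summable fun n => gaussTerm q A B z n -
      (1 - A * z) * (1 - B * z) / ((1 - A * B * z) * (1 - z)) * gaussTerm q A B (z * q) n :=
    hs.sub (hs'.mul_left _)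
  refine tendsto_nhds_unique hd.hasSum.tendsto_sum_nat ?_
  simp_rw [gaussTerm_sub hq hz hABz]
  simp_rw [Finset.sum_range_sub (fun n => -(1 - q ^ n) / (1 - z) * gaussTerm q A B z n)]
  have h1 : Tendsto (fun n : ℕ => -(1 - q ^ n) / (1 - z)) atTop (𝓝 (-(1 - 0) / (1 - z))) :=
    ((tendsto_const_nhds.sub (tendsto_pow_atTop_nhds_zero_of_norm_lt_one hq)).neg).div_const _
  simpa using h1.mul hs.tendsto_atTop_zero

theorem tsum_gaussTerm_eq_mul (hq : ‖q‖ < 1) {A B z : ℂ} (hz : ‖z‖ < 1) (hABz : ‖A * B * z‖ < 1)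
    (m : ℕ) :
    ∑' n, gaussTerm q A B z n =
      qPoch (A * z) q m * qPoch (B * z) q m / (qPoch (A * B * z) q m * qPoch z q m) *
        ∑' n, gaussTerm q A B (z * q ^ m) n := by
  induction m with
  | zero => simp
  | succ m ih =>
    rw [ih, tsum_gaussTerm_step hq (norm_mul_pow_lt_one hq hz m)
      (by simpa only [mul_assoc] using norm_mul_pow_lt_one hq hABz m)]
    simp only [qPoch_succ, pow_succ, mul_assoc]
    rw [← mul_assoc (_ / _) (_ / _), div_mul_div_comm]
    congr 2 <;> ring

/-- The `q`-Gauss sum, in a form without division by the upper parameters. -/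
theorem tsum_gaussTerm (hq : ‖q‖ < 1) {A B z : ℂ} (hz : ‖z‖ < 1) (hABz : ‖A * B * z‖ < 1) :
    ∑' n, gaussTerm q A B z n =
      qPochInf (A * z) q * qPochInf (B * z) q / (qPochInf (A * B * z) q * qPochInf z q) := by
  have h0 : Tendsto (fun m : ℕ => ∑' n, gaussTerm q A B (z * q ^ m) n) atTop
      (𝓝 (∑' n, gaussTerm q A B 0 n)) := by
    obtain ⟨C, hC⟩ := exists_norm_gaussTerm_le hq hABz
    refine tendsto_tsum_of_dominated_convergence
      ((summable_geometric_of_lt_one (norm_nonneg _) hz).mul_left C) (fun n => ?_)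
      (.of_forall hC)
    have hc : ContinuousAt (fun w => gaussTerm q A B w n) 0 := by
      unfold gaussTerm
      refine ContinuousAt.div (by fun_prop) ?_ (by
        simpa using qPoch_ne_zero_of_norm_lt hq hq n)
      unfold qPoch
      fun_prop
    refine hc.tendsto.comp ?_
    simpa using (tendsto_pow_atTop_nhds_zero_of_norm_lt_one hq).const_mul z
  have h1 : ∑' n, gaussTerm q A B 0 n = 1 := by
    rw [tsum_eq_single 0 fun n hn => by simp [gaussTerm, hn]]
    simp [gaussTerm]
  rw [h1] at h0
  have h2 := ((((tendsto_qPoch hq (A * z)).mul (tendsto_qPoch hq (B * z))).div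
    ((tendsto_qPoch hq (A * B * z)).mul (tendsto_qPoch hq z))
    (mul_ne_zero (qPochInf_ne_zero_of_norm_lt hq hABz)
      (qPochInf_ne_zero_of_norm_lt hq hz))).mul h0)
  rw [mul_one] at h2
  exact tendsto_nhds_unique (tendsto_const_nhds.congr (tsum_gaussTerm_eq_mul hq hz hABz)) h2

end Gauss


/-! ### The Bailey pair -/

section BaileyPair

variable {q α lam : ℂ}

/-- The even-indexed entries `α_{2j}` of the Bailey pair whose odd-indexed entries vanish. -/
noncomputable def pairAlpha (q α lam : ℂ) (j : ℕ) : ℂ :=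
  (1 - α * q ^ (4 * j)) * qPoch α (q ^ 2) j * qPoch (q * α / lam) (q ^ 2) j /
    ((1 - α) * qPoch (q ^ 2) (q ^ 2) j * qPoch (q * lam) (q ^ 2) j) * lam ^ j * q ^ (2 * j ^ 2 - j)

/-- The entries `β_n` of the Bailey pair. -/
noncomputable def pairBeta (q α lam : ℂ) (n : ℕ) : ℂ :=
  qPoch lam (q ^ 2) n / (qPoch q q n * qPoch (q * α) (q ^ 2) n * qPoch lam q n)

/-- `1 / (q; q)_{n - 2j}`, understood as `0` for `n < 2j`. -/
noncomputable def invPochSub (q : ℂ) (n j : ℕ) : ℂ :=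
  if 2 * j ≤ n then (qPoch q q (n - 2 * j))⁻¹ else 0

theorem invPochSub_of_lt {n j : ℕ} (h : n < 2 * j) : invPochSub q n j = 0 :=
  if_neg (not_le.2 h)

/-- The multiplied-out form stays valid at the edge of the support: for `n + 1 = 2j` the factor
`q^(2j) - q^(n+1)` vanishes, matching the convention `1/(q; q)_{-1} = 0`. -/
theorem invPochSub_succ (hq : ‖q‖ < 1) (n j : ℕ) :
    q ^ (2 * j) * invPochSub q n j = (q ^ (2 * j) - q * q ^ n) * invPochSub q (n + 1) j := by
  rcases lt_trichotomy (n + 1) (2 * j) with h | h | h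
  · rw [invPochSub_of_lt h, invPochSub_of_lt (by omega)]; simp
  · rw [invPochSub_of_lt (by omega : n < 2 * j), ← h]; ring
  · obtain ⟨m, rfl⟩ : ∃ m, n = 2 * j + m := ⟨n - 2 * j, by omega⟩
    have h1 : 1 - q * q ^ m ≠ 0 := sub_ne_zero.2 (mul_pow_ne_one hq hq m).symm
    rw [invPochSub, invPochSub, if_pos (by omega), if_pos (by omega),
      show 2 * j + m + 1 - 2 * j = m + 1 by omega, show 2 * j + m - 2 * j = m by omega, qPoch_succ,
      mul_inv, pow_add,
      show q ^ (2 * j) - q * (q ^ (2 * j) * q ^ m) = q ^ (2 * j) * (1 - q * q ^ m) by ring]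
    field_simp

theorem invPochSub_succ_right (hq0 : q ≠ 0) (hq : ‖q‖ < 1) (n j : ℕ) :
    (q ^ (2 * j)) ^ 2 * invPochSub q (n + 1) (j + 1) =
      (q ^ (2 * j) - q * q ^ n) * (q ^ (2 * j) - q ^ n) * invPochSub q (n + 1) j := by
  have h1 : invPochSub q (n + 1) (j + 1) =
      if 2 * j + 1 ≤ n then (qPoch q q (n - (2 * j + 1)))⁻¹ else 0 := by
    unfold invPochSub
    rw [show n + 1 - 2 * (j + 1) = n - (2 * j + 1) by omega]
    exact if_congr (by omega) rfl rfl
  rw [h1]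
  split_ifs with h
  · obtain ⟨m, rfl⟩ : ∃ m, n = 2 * j + 1 + m := ⟨n - (2 * j + 1), by omega⟩
    have h1 : 1 - q * q ^ m ≠ 0 := sub_ne_zero.2 (mul_pow_ne_one hq hq m).symm
    have h2 : 1 - q * q ^ (m + 1) ≠ 0 := sub_ne_zero.2 (mul_pow_ne_one hq hq _).symm
    rw [invPochSub, if_pos (by omega), show 2 * j + 1 + m + 1 - 2 * j = m + 1 + 1 by omega,
      show 2 * j + 1 + m - (2 * j + 1) = m by omega, qPoch_succ, qPoch_succ, mul_inv, mul_inv,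
      show q ^ (2 * j) - q * q ^ (2 * j + 1 + m) = q ^ (2 * j) * (1 - q * q ^ (m + 1)) by ring,
      show q ^ (2 * j) - q ^ (2 * j + 1 + m) = q ^ (2 * j) * (1 - q * q ^ m) by ring]
    field_simp
  · rcases (by omega : n = 2 * j ∨ n + 1 = 2 * j ∨ n + 1 < 2 * j) with rfl | h | h
    · simp
    · rw [← h]; ring
    · rw [invPochSub_of_lt h]; simp

theorem mul_pow_four_ne_one (hq : ‖q‖ < 1) (hα : ‖q * α‖ < 1) (hα1 : α ≠ 1) (j : ℕ) :
    α * q ^ (4 * j) ≠ 1 := by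
  cases j with
  | zero => simpa using hα1
  | succ j =>
    rw [show α * q ^ (4 * (j + 1)) = q * α * q ^ (4 * j + 3) by ring]
    exact mul_pow_ne_one hq hα _

theorem pairAlpha_succ (hq : ‖q‖ < 1) (hα : ‖q * α‖ < 1) (hα1 : α ≠ 1) (hlam0 : lam ≠ 0)
    (j : ℕ) :
    pairAlpha q α lam (j + 1) = pairAlpha q α lam j *
      ((1 - α * q ^ 4 * (q ^ (2 * j)) ^ 2) * (1 - α * q ^ (2 * j)) *
          (lam - q * α * q ^ (2 * j)) * (q * (q ^ (2 * j)) ^ 2) /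
        ((1 - α * (q ^ (2 * j)) ^ 2) * (1 - q ^ 2 * q ^ (2 * j)) *
          (1 - q * lam * q ^ (2 * j)))) := by
  have h1 := sub_ne_zero.2 (mul_pow_four_ne_one hq hα hα1 j).symm
  have h2 : 2 * (j + 1) ^ 2 - (j + 1) = 2 * j ^ 2 - j + 4 * j + 1 := by
    have : j ≤ 2 * j ^ 2 := by nlinarith
    have : 2 * (j + 1) ^ 2 = 2 * j ^ 2 + 4 * j + 2 := by ring
    omega
  simp only [pairAlpha, qPoch_succ, h2]
  rw [show q ^ (4 * (j + 1)) = q ^ 4 * (q ^ (2 * j)) ^ 2 by ring,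
    show q ^ (2 * j ^ 2 - j + 4 * j + 1) = q ^ (2 * j ^ 2 - j) * (q * (q ^ (2 * j)) ^ 2) by ring,
    show (q ^ 2) ^ j = q ^ (2 * j) by ring]
  rw [show q ^ (4 * j) = (q ^ (2 * j)) ^ 2 by ring] at *
  rw [show lam - q * α * q ^ (2 * j) = lam * (1 - q * α / lam * q ^ (2 * j)) by field_simp]
  generalize 1 - q * α / lam * q ^ (2 * j) = w
  generalize qPoch (q * α / lam) (q ^ 2) j = w'
  generalize q ^ (2 * j) = y at *
  rw [← mul_assoc α (q ^ 4), pow_succ lam]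
  generalize 1 - α * y ^ 2 = c₁ at *
  generalize 1 - α * q ^ 4 * y ^ 2 = c₂
  generalize 1 - α * y = c₃
  generalize 1 - q ^ 2 * y = c₄
  generalize 1 - q * lam * y = c₅
  generalize 1 - α = c₆
  generalize qPoch α (q ^ 2) j = u₁
  generalize qPoch (q ^ 2) (q ^ 2) j = u₂
  generalize qPoch (q * lam) (q ^ 2) j = u₃
  generalize q ^ (2 * j ^ 2 - j) = u₄
  -- Only `1 - αq^(4j)` has to be cancelled, hence only it must be nonzero; every other inverse
  -- occurs identically on both sides.
  rw [← one_mul (_ / _ * _ * _ : ℂ), ← mul_inv_cancel₀ h1]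
  simp only [div_eq_mul_inv, mul_inv]
  ring

/-- The rational identity behind the recurrence in `n` of the Bailey pair. -/
theorem pair_certificate {N y : ℂ} (hq0 : q ≠ 0) (hy : y ≠ 0)
    (h1 : 1 - α * y ^ 2 ≠ 0) (h2 : 1 - q ^ 2 * y ≠ 0) (h3 : 1 - q * lam * y ≠ 0)
    (h4 : 1 - α * q ^ 4 * y ^ 2 ≠ 0)
    (h5 : 1 - α * q ^ 2 * N * y ≠ 0) (h6 : 1 - α * q ^ 3 * N * y ≠ 0) {D : ℂ} (hD : D ≠ 0)
    (hD' : D = (1 - q * N) * (1 - q * α * N ^ 2) * (1 - lam * N)) :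
    1 - (1 - lam * N ^ 2) / D * ((y - q * N) * (1 - α * q * N * y) / y) =
      (1 - α * q ^ 4 * y ^ 2) * (1 - α * y) * (lam - q * α * y) * (q * y ^ 2) /
          ((1 - α * y ^ 2) * (1 - q ^ 2 * y) * (1 - q * lam * y)) *
        ((y - q * N) * (y - N) / y ^ 2 / ((1 - α * q ^ 2 * N * y) * (1 - α * q ^ 3 * N * y))) *
        (-(q * N) / D * ((1 - q ^ 2 * y) * (1 - q * lam * y) * (1 - α * q ^ 2 * N * y) *
          (1 - α * q ^ 3 * N * y) / (q ^ 2 * y * (1 - α * q ^ 4 * y ^ 2)))) -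
      -(q * N) / D * ((1 - y) * (1 - lam * y / q) * (1 - α * N * y) * (1 - α * q * N * y) /
        (y * (1 - α * y ^ 2))) := by
  -- The factors created by `j ↦ j + 1` cancel against the companion at `j + 1`, leaving a much
  -- smaller identity to clear of denominators.
  have e : (1 - α * q ^ 4 * y ^ 2) * (1 - α * y) * (lam - q * α * y) * (q * y ^ 2) /
          ((1 - α * y ^ 2) * (1 - q ^ 2 * y) * (1 - q * lam * y)) *
        ((y - q * N) * (y - N) / y ^ 2 / ((1 - α * q ^ 2 * N * y) * (1 - α * q ^ 3 * N * y))) *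
        (-(q * N) / D * ((1 - q ^ 2 * y) * (1 - q * lam * y) * (1 - α * q ^ 2 * N * y) *
          (1 - α * q ^ 3 * N * y) / (q ^ 2 * y * (1 - α * q ^ 4 * y ^ 2)))) =
      -N / D * ((1 - α * y) * (lam - q * α * y) * (y - q * N) * (y - N) /
        (y * (1 - α * y ^ 2))) := by
    generalize 1 - α * q ^ 4 * y ^ 2 = c4 at *
    generalize 1 - q ^ 2 * y = c2 at *
    generalize 1 - q * lam * y = c3 at *
    generalize 1 - α * q ^ 2 * N * y = c5 at *
    generalize 1 - α * q ^ 3 * N * y = c6 at *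
    field_simp
  rw [e]
  obtain ⟨c, hc⟩ : ∃ c, c = 1 - α * y ^ 2 := ⟨_, rfl⟩
  rw [← hc] at h1 ⊢
  field_simp
  rw [hD', hc]
  ring

/-- The summand of the defining relation of the Bailey pair. -/
noncomputable def pairTerm (q α lam : ℂ) (n j : ℕ) : ℂ :=
  pairAlpha q α lam j * (invPochSub q n j * (qPoch (q * α) q (n + 2 * j))⁻¹)

theorem pairBeta_succ (q α lam : ℂ) (n : ℕ) :
    pairBeta q α lam (n + 1) = (1 - lam * (q ^ n) ^ 2) /
      ((1 - q * q ^ n) * (1 - q * α * (q ^ n) ^ 2) * (1 - lam * q ^ n)) * pairBeta q α lam n := by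
  simp only [pairBeta, qPoch_succ]
  rw [div_mul_div_comm, ← pow_mul, ← pow_mul, mul_comm 2 n]
  congr 1 <;> ring

/-- A terminating very-well-poised `₆φ₅` sum in base `q²`, read as a Bailey pair relation. -/
theorem sum_pairTerm (hq0 : q ≠ 0) (hq : ‖q‖ < 1) (hα : ‖q * α‖ < 1) (hα1 : α ≠ 1)
    (hlam0 : lam ≠ 0) (hlam : ∀ k : ℕ, lam * q ^ k ≠ 1) (n : ℕ) :
    ∀ J, n < J → ∑ j ∈ Finset.range J, pairTerm q α lam n j = pairBeta q α lam n := by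
  induction n with
  | zero =>
    intro J hJ
    rw [Finset.sum_eq_single_of_mem 0 (Finset.mem_range.2 hJ) fun j _ hj => by
      rw [pairTerm, invPochSub_of_lt (by omega)]; simp]
    have : 1 - α ≠ 0 := sub_ne_zero.2 hα1.symm
    simp [pairTerm, pairAlpha, pairBeta, invPochSub, this]
  | succ n ih =>
    -- Since the range may be any `J > n`, rows `n` and `n + 1` can be summed over the same range.
    intro J hJ
    rw [pairBeta_succ, ← ih J (by omega)]
    set N := q ^ n with hN
    set D := (1 - q * N) * (1 - q * α * N ^ 2) * (1 - lam * N) with hD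
    have hD0 : D ≠ 0 := by
      refine mul_ne_zero (mul_ne_zero ?_ ?_) ?_ <;> refine sub_ne_zero.2 (Ne.symm ?_)
      · exact mul_pow_ne_one hq hq n
      · rw [hN, ← pow_mul]; exact mul_pow_ne_one hq hα _
      · exact hlam n
    rw [Finset.mul_sum, ← sub_eq_zero, ← Finset.sum_sub_distrib]
    -- The telescoping companion. The factor `1 - q^(2j)` kills it at `j = 0`, and the support of
    -- `invPochSub` kills it at `j = J`.
    let G : ℕ → ℂ := fun j => pairTerm q α lam (n + 1) j * (-(q * N) / D *
      ((1 - q ^ (2 * j)) * (1 - lam * q ^ (2 * j) / q) * (1 - α * N * q ^ (2 * j)) *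
        (1 - α * q * N * q ^ (2 * j)) / (q ^ (2 * j) * (1 - α * (q ^ (2 * j)) ^ 2))))
    have key : ∀ j, pairTerm q α lam (n + 1) j - (1 - lam * N ^ 2) / D * pairTerm q α lam n j =
        G (j + 1) - G j := by
      intro j
      have hy : q ^ (2 * j) ≠ 0 := pow_ne_zero _ hq0
      have h1 : 1 - α * (q ^ (2 * j)) ^ 2 ≠ 0 := by
        rw [← pow_mul, show 2 * j * 2 = 4 * j by ring]
        exact sub_ne_zero.2 (mul_pow_four_ne_one hq hα hα1 j).symm
      have h4 : 1 - α * q ^ 4 * (q ^ (2 * j)) ^ 2 ≠ 0 := by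
        rw [show α * q ^ 4 * (q ^ (2 * j)) ^ 2 = α * q ^ (4 * (j + 1)) by ring]
        exact sub_ne_zero.2 (mul_pow_four_ne_one hq hα hα1 _).symm
      have h2 : 1 - q ^ 2 * q ^ (2 * j) ≠ 0 := by
        rw [show q ^ 2 * q ^ (2 * j) = q * q ^ (2 * j + 1) by ring]
        exact sub_ne_zero.2 (mul_pow_ne_one hq hq _).symm
      have h3 : 1 - q * lam * q ^ (2 * j) ≠ 0 := by
        rw [show q * lam * q ^ (2 * j) = lam * q ^ (2 * j + 1) by ring]
        exact sub_ne_zero.2 (hlam _).symm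
      have h7 : 1 - α * q * N * q ^ (2 * j) ≠ 0 := by
        rw [hN, show α * q * q ^ n * q ^ (2 * j) = q * α * q ^ (n + 2 * j) by ring]
        exact sub_ne_zero.2 (mul_pow_ne_one hq hα _).symm
      have h5 : 1 - α * q ^ 2 * N * q ^ (2 * j) ≠ 0 := by
        rw [hN, show α * q ^ 2 * q ^ n * q ^ (2 * j) = q * α * q ^ (n + 2 * j + 1) by ring]
        exact sub_ne_zero.2 (mul_pow_ne_one hq hα _).symm
      have h6 : 1 - α * q ^ 3 * N * q ^ (2 * j) ≠ 0 := by
        rw [hN, show α * q ^ 3 * q ^ n * q ^ (2 * j) = q * α * q ^ (n + 2 * j + 2) by ring]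
        exact sub_ne_zero.2 (mul_pow_ne_one hq hα _).symm
      have hT : pairTerm q α lam n j = pairTerm q α lam (n + 1) j *
          ((q ^ (2 * j) - q * N) * (1 - α * q * N * q ^ (2 * j)) / q ^ (2 * j)) := by
        have e1 : invPochSub q n j =
            (q ^ (2 * j) - q * N) * invPochSub q (n + 1) j / q ^ (2 * j) := by
          rw [eq_div_iff hy, mul_comm, invPochSub_succ hq]
        have e2 : qPoch (q * α) q (n + 1 + 2 * j) =
            qPoch (q * α) q (n + 2 * j) * (1 - α * q * N * q ^ (2 * j)) := by
          rw [show n + 1 + 2 * j = n + 2 * j + 1 by ring, qPoch_succ, hN, pow_add]; ring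
        rw [pairTerm, pairTerm, e1, e2]
        generalize 1 - α * q * N * q ^ (2 * j) = c at *
        field_simp
      have hT' : pairTerm q α lam (n + 1) (j + 1) = pairTerm q α lam (n + 1) j *
          (((1 - α * q ^ 4 * (q ^ (2 * j)) ^ 2) * (1 - α * q ^ (2 * j)) *
            (lam - q * α * q ^ (2 * j)) * (q * (q ^ (2 * j)) ^ 2) /
          ((1 - α * (q ^ (2 * j)) ^ 2) * (1 - q ^ 2 * q ^ (2 * j)) *
            (1 - q * lam * q ^ (2 * j)))) *
          ((q ^ (2 * j) - q * N) * (q ^ (2 * j) - N) / (q ^ (2 * j)) ^ 2 /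
            ((1 - α * q ^ 2 * N * q ^ (2 * j)) * (1 - α * q ^ 3 * N * q ^ (2 * j))))) := by
        have e1 : invPochSub q (n + 1) (j + 1) =
            (q ^ (2 * j) - q * N) * (q ^ (2 * j) - N) * invPochSub q (n + 1) j /
              (q ^ (2 * j)) ^ 2 := by
          rw [eq_div_iff (pow_ne_zero _ hy), mul_comm, invPochSub_succ_right hq0 hq]
        have e2 : qPoch (q * α) q (n + 1 + 2 * (j + 1)) = qPoch (q * α) q (n + 1 + 2 * j) *
            ((1 - α * q ^ 2 * N * q ^ (2 * j)) * (1 - α * q ^ 3 * N * q ^ (2 * j))) := by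
          rw [show n + 1 + 2 * (j + 1) = n + 1 + 2 * j + 1 + 1 by ring, qPoch_succ, qPoch_succ, hN]
          ring
        rw [pairTerm, pairTerm, pairAlpha_succ hq hα hα1 hlam0, e1, e2]
        rw [mul_inv]
        ring
      have hc := pair_certificate hq0 hy h1 h2 h3 h4 h5 h6 hD0 hD
      simp only [G]
      rw [hT, hT', show q ^ (2 * (j + 1)) = q ^ 2 * q ^ (2 * j) by ring]
      have hc' := congrArg (pairTerm q α lam (n + 1) j * ·) hc
      have s1 : 1 - lam * (q ^ 2 * q ^ (2 * j)) / q = 1 - q * lam * q ^ (2 * j) := by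
        field_simp
      rw [s1, show α * N * (q ^ 2 * q ^ (2 * j)) = α * q ^ 2 * N * q ^ (2 * j) by ring,
        show α * q * N * (q ^ 2 * q ^ (2 * j)) = α * q ^ 3 * N * q ^ (2 * j) by ring,
        show α * (q ^ 2 * q ^ (2 * j)) ^ 2 = α * q ^ 4 * (q ^ (2 * j)) ^ 2 by ring]
      linear_combination hc'
    rw [Finset.sum_congr rfl fun j _ => key j, Finset.sum_range_sub]
    simp only [G]
    rw [pairTerm, invPochSub_of_lt (by omega : n + 1 < 2 * J)]
    simp

end BaileyPair


/-! ### Bailey's lemma for this pair -/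

section BaileyLemma

variable {q α lam : ℂ}

/-- The ratio of consecutive entries is a rational function of `y = q^(2j)`, continuous at `0` and
vanishing there thanks to the factor `q y²`. -/
theorem summable_pairAlpha (hq : ‖q‖ < 1) (hα : ‖q * α‖ < 1) (hα1 : α ≠ 1)
    (hlam0 : lam ≠ 0) : Summable (pairAlpha q α lam) := by
  have hy : Tendsto (fun j : ℕ => q ^ (2 * j)) atTop (𝓝 0) := by
    simp_rw [pow_mul]
    exact tendsto_pow_atTop_nhds_zero_of_norm_lt_one (by
      rw [norm_pow]; exact pow_lt_one₀ (norm_nonneg _) hq two_ne_zero)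
  have hc : ContinuousAt (fun y : ℂ =>
      (1 - α * q ^ 4 * y ^ 2) * (1 - α * y) * (lam - q * α * y) * (q * y ^ 2) /
        ((1 - α * y ^ 2) * (1 - q ^ 2 * y) * (1 - q * lam * y))) 0 :=
    ContinuousAt.div (by fun_prop) (by fun_prop) (by simp)
  have ht := (hc.tendsto.comp hy).norm
  have he := ht.eventually (gt_mem_nhds (show _ < (1 / 2 : ℝ) by norm_num))
  refine summable_of_ratio_norm_eventually_le (r := 1 / 2) (by norm_num) (he.mono fun j hj => ?_)
  rw [pairAlpha_succ hq hα hα1 hlam0, norm_mul, mul_comm]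
  exact mul_le_mul_of_nonneg_right hj.le (norm_nonneg _)

theorem exists_norm_invPochSub_le (hq : ‖q‖ < 1) :
    ∃ M : ℝ, 0 < M ∧ ∀ n j, ‖invPochSub q n j‖ ≤ M := by
  obtain ⟨M, hM, h⟩ := exists_norm_inv_qPoch_le hq (mul_pow_ne_one hq hq)
  refine ⟨M, hM, fun n j => ?_⟩
  unfold invPochSub
  split_ifs
  · exact h _
  · simpa using hM.le

/-- All shifted factorials are bounded, so the family is dominated by the product of the geometric
series in `z` and the series of `pairAlpha`. This justifies interchanging the sums. -/
theorem summable_bailey (hq : ‖q‖ < 1) (hα : ‖q * α‖ < 1) (hα1 : α ≠ 1) (hlam0 : lam ≠ 0)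
    (ρ₁ ρ₂ : ℂ) {z : ℂ} (hz : ‖z‖ < 1) :
    Summable fun p : ℕ × ℕ =>
      qPoch ρ₁ q p.1 * qPoch ρ₂ q p.1 * z ^ p.1 * pairTerm q α lam p.1 p.2 := by
  obtain ⟨M₁, h₁, H₁⟩ := exists_norm_qPoch_le_of_fixed hq ρ₁
  obtain ⟨M₂, h₂, H₂⟩ := exists_norm_qPoch_le_of_fixed hq ρ₂
  obtain ⟨M₃, h₃, H₃⟩ := exists_norm_invPochSub_le hq
  obtain ⟨M₄, h₄, H₄⟩ := exists_norm_inv_qPoch_le hq (mul_pow_ne_one hq hα)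
  have hs := (summable_geometric_of_lt_one (norm_nonneg _) hz).mul_of_nonneg
    (summable_pairAlpha hq hα hα1 hlam0).norm (fun _ => by positivity) fun _ => by positivity
  refine .of_norm_bounded (hs.mul_left (M₁ * M₂ * (M₃ * M₄))) fun ⟨n, j⟩ => ?_
  simp only [pairTerm, norm_mul, norm_pow]
  calc _ ≤ M₁ * M₂ * ‖z‖ ^ n * (‖pairAlpha q α lam j‖ * (M₃ * M₄)) := by
        gcongr
        exacts [H₁ n, H₂ n, H₃ n j, H₄ _]
    _ = _ := by ring

theorem tsum_pairTerm (hq0 : q ≠ 0) (hq : ‖q‖ < 1) (hα : ‖q * α‖ < 1) (hα1 : α ≠ 1)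
    (hlam0 : lam ≠ 0) (hlam : ∀ k : ℕ, lam * q ^ k ≠ 1) (n : ℕ) :
    ∑' j, pairTerm q α lam n j = pairBeta q α lam n := by
  rw [tsum_eq_sum (s := Finset.range (n + 1)), sum_pairTerm hq0 hq hα hα1 hlam0 hlam n _ (by simp)]
  intro j hj
  rw [Finset.mem_range, not_lt] at hj
  rw [pairTerm, invPochSub_of_lt (by omega)]
  simp

/-- The terms with `n < 2j` vanish. After the shift `n = m + 2j`, the hypothesis `qα = ρ₁ρ₂z` makes
the series a `q`-Gauss series with upper parameters `ρ₁q^(2j)`, `ρ₂q^(2j)`. -/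
theorem tsum_bailey_inner (hq : ‖q‖ < 1) {ρ₁ ρ₂ z : ℂ} (hz : ‖z‖ < 1)
    (hα : ‖q * α‖ < 1) (hαz : q * α = ρ₁ * ρ₂ * z) (j : ℕ)
    (hs : Summable fun n => qPoch ρ₁ q n * qPoch ρ₂ q n * z ^ n * pairTerm q α lam n j) :
    ∑' n, qPoch ρ₁ q n * qPoch ρ₂ q n * z ^ n * pairTerm q α lam n j =
      pairAlpha q α lam j * z ^ (2 * j) * (qPoch ρ₁ q (2 * j) * qPoch ρ₂ q (2 * j)) *
        (qPochInf (ρ₁ * z * q ^ (2 * j)) q * qPochInf (ρ₂ * z * q ^ (2 * j)) q) /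
          (qPochInf (q * α) q * qPochInf z q) := by
  rw [← hs.sum_add_tsum_nat_add (2 * j), Finset.sum_eq_zero fun n hn => by
    rw [pairTerm, invPochSub_of_lt (Finset.mem_range.1 hn)]; simp, zero_add]
  have hprod : ρ₁ * q ^ (2 * j) * (ρ₂ * q ^ (2 * j)) * z = q * α * q ^ (4 * j) := by
    rw [hαz]; ring
  have hterm : ∀ m, qPoch ρ₁ q (m + 2 * j) * qPoch ρ₂ q (m + 2 * j) * z ^ (m + 2 * j) *
        pairTerm q α lam (m + 2 * j) j =
      pairAlpha q α lam j * z ^ (2 * j) * (qPoch ρ₁ q (2 * j) * qPoch ρ₂ q (2 * j)) /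
        qPoch (q * α) q (4 * j) * gaussTerm q (ρ₁ * q ^ (2 * j)) (ρ₂ * q ^ (2 * j)) z m := by
    intro m
    rw [pairTerm, invPochSub, if_pos (by omega), Nat.add_sub_cancel, gaussTerm, hprod,
      show m + 2 * j + 2 * j = 4 * j + m by ring, add_comm m, qPoch_add, qPoch_add, qPoch_add,
      pow_add]
    simp only [div_eq_mul_inv, mul_inv]
    ring
  simp_rw [hterm]
  rw [tsum_mul_left, tsum_gaussTerm hq hz (hprod ▸ norm_mul_pow_lt_one hq hα _), hprod,
    qPochInf_eq_qPoch_mul hq (q * α) (4 * j), mul_right_comm ρ₁, mul_right_comm ρ₂,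
    div_mul_div_comm, mul_assoc (qPoch (q * α) q (4 * j))]

/-- Bailey's lemma for the pair `pairAlpha`, `pairBeta`. -/
theorem tsum_bailey (hq0 : q ≠ 0) (hq : ‖q‖ < 1) (hα : ‖q * α‖ < 1) (hα1 : α ≠ 1)
    (hlam0 : lam ≠ 0) (hlam : ∀ k : ℕ, lam * q ^ k ≠ 1) {ρ₁ ρ₂ z : ℂ} (hz : ‖z‖ < 1)
    (hαz : q * α = ρ₁ * ρ₂ * z) :
    HasSum (fun j => pairAlpha q α lam j * z ^ (2 * j) *
        (qPoch ρ₁ q (2 * j) * qPoch ρ₂ q (2 * j)) *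
        (qPochInf (ρ₁ * z * q ^ (2 * j)) q * qPochInf (ρ₂ * z * q ^ (2 * j)) q) /
          (qPochInf (q * α) q * qPochInf z q))
      (∑' n, qPoch ρ₁ q n * qPoch ρ₂ q n * z ^ n * pairBeta q α lam n) := by
  have hs := summable_bailey hq hα hα1 hlam0 ρ₁ ρ₂ hz
  have h3 : HasSum
      (fun j => ∑' n, qPoch ρ₁ q n * qPoch ρ₂ q n * z ^ n * pairTerm q α lam n j)
      (∑' j, ∑' n, qPoch ρ₁ q n * qPoch ρ₂ q n * z ^ n * pairTerm q α lam n j) :=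
    hs.prod_symm.prod.hasSum
  have h4 : ∑' j, ∑' n, qPoch ρ₁ q n * qPoch ρ₂ q n * z ^ n * pairTerm q α lam n j =
      ∑' n, qPoch ρ₁ q n * qPoch ρ₂ q n * z ^ n * pairBeta q α lam n := by
    rw [Summable.tsum_comm (f := fun n j =>
      qPoch ρ₁ q n * qPoch ρ₂ q n * z ^ n * pairTerm q α lam n j) hs]
    exact tsum_congr fun n => by
      rw [← tsum_pairTerm hq0 hq hα hα1 hlam0 hlam n, ← tsum_mul_left]
  rw [h4] at h3
  refine h3.congr_fun fun j => ?_
  exact (tsum_bailey_inner hq hz hα hαz j (hs.prod_symm.prod_factor j)).symm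

theorem summable_pairBeta (hq0 : q ≠ 0) (hq : ‖q‖ < 1) (hα : ‖q * α‖ < 1) (hα1 : α ≠ 1)
    (hlam0 : lam ≠ 0) (hlam : ∀ k : ℕ, lam * q ^ k ≠ 1) (ρ₁ ρ₂ : ℂ) {z : ℂ} (hz : ‖z‖ < 1) :
    Summable fun n => qPoch ρ₁ q n * qPoch ρ₂ q n * z ^ n * pairBeta q α lam n := by
  refine (summable_bailey hq hα hα1 hlam0 ρ₁ ρ₂ hz).prod.congr fun n => ?_
  rw [← tsum_pairTerm hq0 hq hα hα1 hlam0 hlam n, ← tsum_mul_left]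

theorem phiTerm_eq_mul_pairBeta {μ ν : ℂ} (hμ : μ ^ 2 = lam) (hν : ν ^ 2 = q * α)
    (ρ₁ ρ₂ z : ℂ) (n : ℕ) :
    phiTerm [ρ₁, ρ₂, μ, -μ] [ν, -ν, lam] q z n =
      qPoch ρ₁ q n * qPoch ρ₂ q n * z ^ n * pairBeta q α lam n := by
  simp only [phiTerm, qPochs, pairBeta, List.map_cons, List.map_nil, List.prod_cons,
    List.prod_nil, mul_one]
  rw [qPoch_mul_neg, ← mul_assoc (qPoch ν q n), qPoch_mul_neg, hμ, hν]
  ring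

end BaileyLemma


/-! ### Rahman's kernel and its companion -/

section Kernel

variable {q : ℂ}

/-- `(t₁w, …, t₅w; q)_∞`. -/
noncomputable def pochProd (q t₁ t₂ t₃ t₄ t₅ w : ℂ) : ℂ :=
  qPochInf (t₁ * w) q * qPochInf (t₂ * w) q * qPochInf (t₃ * w) q * qPochInf (t₄ * w) q *
    qPochInf (t₅ * w) q

/-- The integrand of Rahman's integral as a function of `z = e^{iθ}`. -/
noncomputable def kernel (q t₁ t₂ t₃ t₄ t₅ z : ℂ) : ℂ :=
  qPochInf (z ^ 2) q * qPochInf (z⁻¹ ^ 2) q *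
    (qPochInf (t₁ * t₂ * t₃ * t₄ * t₅ * z) q * qPochInf (t₁ * t₂ * t₃ * t₄ * t₅ * z⁻¹) q) /
    (pochProd q t₁ t₂ t₃ t₄ t₅ z * pochProd q t₁ t₂ t₃ t₄ t₅ z⁻¹)

/-- The function whose antisymmetry under `z ↦ 1 / (qz)` produces the functional equation of
Rahman's integral. -/
noncomputable def cokernel (q t₁ t₂ t₃ t₄ t₅ z : ℂ) : ℂ :=
  z⁻¹ * (qPochInf (q * z ^ 2) q * qPochInf (z⁻¹ ^ 2) q *
    (qPochInf (q * (t₁ * t₂ * t₃ * t₄ * t₅ * z)) q * qPochInf (t₁ * t₂ * t₃ * t₄ * t₅ * z⁻¹) q) /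
    (pochProd q t₁ t₂ t₃ t₄ t₅ (q * z) * pochProd q t₁ t₂ t₃ t₄ t₅ z⁻¹))

theorem pochProd_eq_mul (hq : ‖q‖ < 1) (t₁ t₂ t₃ t₄ t₅ w : ℂ) :
    pochProd q t₁ t₂ t₃ t₄ t₅ w = ((1 - t₁ * w) * (1 - t₂ * w) * (1 - t₃ * w) * (1 - t₄ * w) *
      (1 - t₅ * w)) * pochProd q t₁ t₂ t₃ t₄ t₅ (q * w) := by
  simp only [pochProd]
  rw [qPochInf_eq_mul hq (t₁ * w), qPochInf_eq_mul hq (t₂ * w), qPochInf_eq_mul hq (t₃ * w),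
    qPochInf_eq_mul hq (t₄ * w), qPochInf_eq_mul hq (t₅ * w)]
  simp only [mul_left_comm q]
  ring

theorem pochProd_mul_left (hq : ‖q‖ < 1) (t₁ t₂ t₃ t₄ t₅ w : ℂ) :
    pochProd q (q * t₁) t₂ t₃ t₄ t₅ w = ((1 - t₂ * w) * (1 - t₃ * w) * (1 - t₄ * w) *
      (1 - t₅ * w)) * pochProd q t₁ t₂ t₃ t₄ t₅ (q * w) := by
  simp only [pochProd]
  rw [qPochInf_eq_mul hq (t₂ * w), qPochInf_eq_mul hq (t₃ * w),
    qPochInf_eq_mul hq (t₄ * w), qPochInf_eq_mul hq (t₅ * w)]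
  simp only [mul_left_comm q, mul_assoc q]
  ring

theorem pochProd_ne_zero (hq : ‖q‖ < 1) {t₁ t₂ t₃ t₄ t₅ w : ℂ} (h₁ : ‖t₁‖ < 1) (h₂ : ‖t₂‖ < 1)
    (h₃ : ‖t₃‖ < 1) (h₄ : ‖t₄‖ < 1) (h₅ : ‖t₅‖ < 1) (hw : ‖w‖ ≤ 1) :
    pochProd q t₁ t₂ t₃ t₄ t₅ w ≠ 0 := by
  have key : ∀ t : ℂ, ‖t‖ < 1 → qPochInf (t * w) q ≠ 0 := fun t ht =>
    qPochInf_ne_zero_of_norm_lt hq (by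
      rw [norm_mul]; exact (mul_le_of_le_one_right (norm_nonneg _) hw).trans_lt ht)
  simp only [pochProd, mul_ne_zero_iff]
  exact ⟨⟨⟨⟨key _ h₁, key _ h₂⟩, key _ h₃⟩, key _ h₄⟩, key _ h₅⟩

theorem differentiable_pochProd (hq : ‖q‖ < 1) (t₁ t₂ t₃ t₄ t₅ : ℂ) :
    Differentiable ℂ (pochProd q t₁ t₂ t₃ t₄ t₅) := by
  have key : ∀ t : ℂ, Differentiable ℂ fun w => qPochInf (t * w) q := fun t =>
    (differentiable_qPochInf hq).comp (differentiable_id.const_mul t)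
  unfold pochProd
  exact ((((key _).mul (key _)).mul (key _)).mul (key _)).mul (key _)

/-- The reflection swaps the infinite products in pairs, apart from one elementary factor in each of
two products; with the prefactor `z⁻¹` these produce exactly the sign. -/
theorem cokernel_reflect (hq0 : q ≠ 0) (hq : ‖q‖ < 1) (t₁ t₂ t₃ t₄ t₅ : ℂ) {z : ℂ} (hz : z ≠ 0) :
    cokernel q t₁ t₂ t₃ t₄ t₅ (q * z)⁻¹ = -cokernel q t₁ t₂ t₃ t₄ t₅ z := by
  simp only [cokernel, inv_inv]
  generalize t₁ * t₂ * t₃ * t₄ * t₅ = A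
  have e1 : qPochInf (q * (q * z)⁻¹ ^ 2) q =
      (1 - q⁻¹ * z⁻¹ ^ 2) * qPochInf (z⁻¹ ^ 2) q := by
    rw [qPochInf_eq_mul hq, show q * (q * z)⁻¹ ^ 2 = q⁻¹ * z⁻¹ ^ 2 by field_simp,
      show q * (q⁻¹ * z⁻¹ ^ 2) = z⁻¹ ^ 2 by field_simp]
  have e2 : qPochInf (q * z ^ 2) q = (1 - q * z ^ 2) * qPochInf ((q * z) ^ 2) q := by
    rw [qPochInf_eq_mul hq]; congr 2; ring
  rw [e1, e2, show q * (A * (q * z)⁻¹) = A * z⁻¹ by field_simp,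
    show q * (q * z)⁻¹ = z⁻¹ by field_simp, show A * (q * z) = q * (A * z) by ring,
    mul_comm (pochProd _ _ _ _ _ _ z⁻¹)]
  have : q * z * (1 - q⁻¹ * z⁻¹ ^ 2) = -(z⁻¹ * (1 - q * z ^ 2)) := by field_simp; ring
  linear_combination (qPochInf (z⁻¹ ^ 2) q * qPochInf ((q * z) ^ 2) q *
    (qPochInf (A * z⁻¹) q * qPochInf (q * (A * z)) q) /
      (pochProd q t₁ t₂ t₃ t₄ t₅ (q * z) * pochProd q t₁ t₂ t₃ t₄ t₅ z⁻¹)) * this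

/-- What remains of `kernel_mul_left` once the common infinite products are divided out. -/
theorem kernel_certificate (t₁ t₂ t₃ t₄ t₅ : ℂ) {z : ℂ} (hz : z ≠ 0) :
    (1 - z ^ 2) * (1 - z⁻¹ ^ 2) *
      ((1 - t₁ * t₃ * t₄ * t₅) * (1 - t₁ * t₂ * t₄ * t₅) * (1 - t₁ * t₂ * t₃ * t₅) *
          (1 - t₁ * t₂ * t₃ * t₄) * ((1 - t₁ * z) * (1 - t₁ * z⁻¹)) -
        (1 - t₁ * t₂) * (1 - t₁ * t₃) * (1 - t₁ * t₄) * (1 - t₁ * t₅) *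
          ((1 - t₁ * t₂ * t₃ * t₄ * t₅ * z) * (1 - t₁ * t₂ * t₃ * t₄ * t₅ * z⁻¹))) =
      -(t₁ * (1 - t₁ * t₂ * t₃ * t₄ * t₅ * t₁)) *
        (z⁻¹ * (1 - z⁻¹ ^ 2) * (1 - t₁ * t₂ * t₃ * t₄ * t₅ * z⁻¹) *
            ((1 - t₁ * z) * (1 - t₂ * z) * (1 - t₃ * z) * (1 - t₄ * z) * (1 - t₅ * z)) +
          z * (1 - z ^ 2) * (1 - t₁ * t₂ * t₃ * t₄ * t₅ * z) *
            ((1 - t₁ * z⁻¹) * (1 - t₂ * z⁻¹) * (1 - t₃ * z⁻¹) * (1 - t₄ * z⁻¹) *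
              (1 - t₅ * z⁻¹))) := by
  field_simp
  ring

end Kernel


/-! ### Pointwise functional equation of the kernel -/

section FunctionalEquation

variable {q : ℂ}

theorem kernel_mul_left (hq : ‖q‖ < 1) {t₁ t₂ t₃ t₄ t₅ z : ℂ} (h₁ : ‖t₁‖ < 1)
    (h₂ : ‖t₂‖ < 1) (h₃ : ‖t₃‖ < 1) (h₄ : ‖t₄‖ < 1) (h₅ : ‖t₅‖ < 1) (hz : ‖z‖ = 1) :
    (1 - t₁ * t₃ * t₄ * t₅) * (1 - t₁ * t₂ * t₄ * t₅) * (1 - t₁ * t₂ * t₃ * t₅) *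
          (1 - t₁ * t₂ * t₃ * t₄) * kernel q (q * t₁) t₂ t₃ t₄ t₅ z -
        (1 - t₁ * t₂) * (1 - t₁ * t₃) * (1 - t₁ * t₄) * (1 - t₁ * t₅) *
          kernel q t₁ t₂ t₃ t₄ t₅ z =
      -(t₁ * (1 - t₁ * t₂ * t₃ * t₄ * t₅ * t₁)) *
        (cokernel q t₁ t₂ t₃ t₄ t₅ z + cokernel q t₁ t₂ t₃ t₄ t₅ z⁻¹) := by
  have hz0 : z ≠ 0 := by rintro rfl; simp at hz
  have hz' : ‖z⁻¹‖ = 1 := by rw [norm_inv, hz, inv_one]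
  have hc := kernel_certificate t₁ t₂ t₃ t₄ t₅ hz0
  have hE := pochProd_ne_zero hq h₁ h₂ h₃ h₄ h₅ hz.le
  have hE' := pochProd_ne_zero hq h₁ h₂ h₃ h₄ h₅ hz'.le
  have hR := pochProd_eq_mul hq t₁ t₂ t₃ t₄ t₅ z
  have hR' := pochProd_eq_mul hq t₁ t₂ t₃ t₄ t₅ z⁻¹
  simp only [kernel, cokernel, inv_inv]
  rw [pochProd_mul_left hq, pochProd_mul_left hq,
    show q * t₁ * t₂ * t₃ * t₄ * t₅ = q * (t₁ * t₂ * t₃ * t₄ * t₅) by ring,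
    qPochInf_eq_mul hq (z ^ 2), qPochInf_eq_mul hq (z⁻¹ ^ 2),
    qPochInf_eq_mul hq (t₁ * t₂ * t₃ * t₄ * t₅ * z),
    qPochInf_eq_mul hq (t₁ * t₂ * t₃ * t₄ * t₅ * z⁻¹), mul_assoc q, mul_assoc q]
  rw [hR] at hE ⊢
  rw [hR'] at hE' ⊢
  clear hR hR'
  generalize t₁ * t₂ * t₃ * t₄ * t₅ = A at *
  simp only [mul_ne_zero_iff] at hE hE'
  obtain ⟨⟨⟨⟨⟨a₁, a₂⟩, a₃⟩, a₄⟩, a₅⟩, a₆⟩ := hE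
  obtain ⟨⟨⟨⟨⟨b₁, b₂⟩, b₃⟩, b₄⟩, b₅⟩, b₆⟩ := hE'
  generalize (1 - t₁ * t₃ * t₄ * t₅) * (1 - t₁ * t₂ * t₄ * t₅) * (1 - t₁ * t₂ * t₃ * t₅) *
          (1 - t₁ * t₂ * t₃ * t₄) = K at *
  generalize (1 - t₁ * t₂) * (1 - t₁ * t₃) * (1 - t₁ * t₄) * (1 - t₁ * t₅) = L at *
  generalize t₁ * (1 - A * t₁) = c at *
  generalize pochProd q t₁ t₂ t₃ t₄ t₅ (q * z) = E at *
  generalize pochProd q t₁ t₂ t₃ t₄ t₅ (q * z⁻¹) = E' at *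
  generalize qPochInf (q * z ^ 2) q = X
  generalize qPochInf (q * z⁻¹ ^ 2) q = X'
  generalize qPochInf (q * (A * z)) q = Y
  generalize qPochInf (q * (A * z⁻¹)) q = Y'
  generalize 1 - z ^ 2 = s at *
  generalize 1 - z⁻¹ ^ 2 = s' at *
  generalize 1 - A * z = u at *
  generalize 1 - A * z⁻¹ = u' at *
  generalize 1 - t₁ * z = p₁ at *
  generalize 1 - t₂ * z = p₂ at *
  generalize 1 - t₃ * z = p₃ at *
  generalize 1 - t₄ * z = p₄ at *
  generalize 1 - t₅ * z = p₅ at *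
  generalize 1 - t₁ * z⁻¹ = r₁ at *
  generalize 1 - t₂ * z⁻¹ = r₂ at *
  generalize 1 - t₃ * z⁻¹ = r₃ at *
  generalize 1 - t₄ * z⁻¹ = r₄ at *
  generalize 1 - t₅ * z⁻¹ = r₅ at *
  generalize z⁻¹ = w at *
  have hD : p₁ * p₂ * p₃ * p₄ * p₅ * (r₁ * r₂ * r₃ * r₄ * r₅) * (E * E') ≠ 0 := by
    simp only [mul_ne_zero_iff]; tauto
  have k1 : s * X * (s' * X') * (Y * Y') / (p₂ * p₃ * p₄ * p₅ * E * (r₂ * r₃ * r₄ * r₅ * E')) =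
      s * X * (s' * X') * (Y * Y') * (p₁ * r₁) /
        (p₁ * p₂ * p₃ * p₄ * p₅ * (r₁ * r₂ * r₃ * r₄ * r₅) * (E * E')) := by
    field_simp
  have k2 : X * (s' * X') * (Y * (u' * Y')) / (E * (r₁ * r₂ * r₃ * r₄ * r₅ * E')) =
      X * (s' * X') * (Y * (u' * Y')) * (p₁ * p₂ * p₃ * p₄ * p₅) /
        (p₁ * p₂ * p₃ * p₄ * p₅ * (r₁ * r₂ * r₃ * r₄ * r₅) * (E * E')) := by
    field_simp
  have k3 : X' * (s * X) * (Y' * (u * Y)) / (E' * (p₁ * p₂ * p₃ * p₄ * p₅ * E)) =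
      X' * (s * X) * (Y' * (u * Y)) * (r₁ * r₂ * r₃ * r₄ * r₅) /
        (p₁ * p₂ * p₃ * p₄ * p₅ * (r₁ * r₂ * r₃ * r₄ * r₅) * (E * E')) := by
    field_simp
  have k4 : s * X * (s' * X') * (u * Y * (u' * Y')) /
        (p₁ * p₂ * p₃ * p₄ * p₅ * E * (r₁ * r₂ * r₃ * r₄ * r₅ * E')) =
      s * X * (s' * X') * (u * Y * (u' * Y')) /
        (p₁ * p₂ * p₃ * p₄ * p₅ * (r₁ * r₂ * r₃ * r₄ * r₅) * (E * E')) := by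
    congr 1; ring
  rw [k1, k2, k3, k4]
  generalize p₁ * p₂ * p₃ * p₄ * p₅ * (r₁ * r₂ * r₃ * r₄ * r₅) * (E * E') = D at *
  linear_combination (X * X' * Y * Y' / D) * hc

end FunctionalEquation

/-! ### Vanishing of the companion's circle mean -/

section Integral

variable {q : ℝ}

theorem norm_ofReal_lt_one (hq0 : 0 < q) (hq1 : q < 1) : ‖(q : ℂ)‖ < 1 := by
  rwa [Complex.norm_real, Real.norm_of_nonneg hq0.le]

/-- On this closed annulus both `qz` and `z⁻¹` lie in the closed unit disc, where the denominator
products have no zeros. -/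
theorem differentiableAt_cokernel (hq0 : 0 < q) (hq1 : q < 1) {t₁ t₂ t₃ t₄ t₅ z : ℂ}
    (h₁ : ‖t₁‖ < 1) (h₂ : ‖t₂‖ < 1) (h₃ : ‖t₃‖ < 1) (h₄ : ‖t₄‖ < 1) (h₅ : ‖t₅‖ < 1)
    (hz : 1 ≤ ‖z‖) (hz' : ‖z‖ ≤ q⁻¹) :
    DifferentiableAt ℂ (cokernel q t₁ t₂ t₃ t₄ t₅) z := by
  have hq := norm_ofReal_lt_one hq0 hq1
  have hz0 : z ≠ 0 := by rintro rfl; simp at hz; linarith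
  have hP := differentiable_qPochInf hq
  have hE := differentiable_pochProd hq t₁ t₂ t₃ t₄ t₅
  have hi : DifferentiableAt ℂ (fun z : ℂ => z⁻¹) z := differentiableAt_inv hz0
  have n1 := pochProd_ne_zero hq h₁ h₂ h₃ h₄ h₅ (w := q * z) (by
    rw [norm_mul, Complex.norm_real, Real.norm_of_nonneg hq0.le]
    calc q * ‖z‖ ≤ q * q⁻¹ := by gcongr
      _ = 1 := mul_inv_cancel₀ hq0.ne')
  have n2 := pochProd_ne_zero hq h₁ h₂ h₃ h₄ h₅ (w := z⁻¹) (by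
    rw [norm_inv]; exact inv_le_one_of_one_le₀ hz)
  have comp : ∀ {f : ℂ → ℂ}, DifferentiableAt ℂ f z →
      DifferentiableAt ℂ (fun z => qPochInf (f z) (q : ℂ)) z := fun hf => (hP _).comp z hf
  unfold cokernel
  refine hi.mul (DifferentiableAt.div ?_ ?_ (mul_ne_zero n1 n2))
  · refine ((comp (by fun_prop)).mul (comp (hi.pow 2))).mul
      ((comp (by fun_prop)).mul (comp (hi.const_mul _)))
  · exact ((hE _).comp z (by fun_prop)).mul ((hE _).comp z hi)

/-- By Cauchy's theorem the means over `|z| = 1` and `|z| = 1/q` agree; `z ↦ 1/(qz)` exchanges the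
circles and changes the sign, so the mean equals its own negative. -/
theorem integral_cokernel (hq0 : 0 < q) (hq1 : q < 1) {t₁ t₂ t₃ t₄ t₅ : ℂ}
    (h₁ : ‖t₁‖ < 1) (h₂ : ‖t₂‖ < 1) (h₃ : ‖t₃‖ < 1) (h₄ : ‖t₄‖ < 1) (h₅ : ‖t₅‖ < 1) :
    ∫ θ in (0 : ℝ)..2 * π, cokernel q t₁ t₂ t₃ t₄ t₅ (circleMap 0 1 θ) = 0 := by
  have hq := norm_ofReal_lt_one hq0 hq1
  have hqc : (q : ℂ) ≠ 0 := by exact_mod_cast hq0.ne'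
  set g := cokernel q t₁ t₂ t₃ t₄ t₅ with hg
  have hd : ∀ z : ℂ, 1 ≤ ‖z‖ → ‖z‖ ≤ q⁻¹ → DifferentiableAt ℂ g z := fun z =>
    differentiableAt_cokernel hq0 hq1 h₁ h₂ h₃ h₄ h₅
  have hann := Complex.circleIntegral_sub_center_inv_smul_eq_of_differentiable_on_annulus_off_countable
    (c := 0) (r := 1) (R := q⁻¹) one_pos ((one_le_inv₀ hq0).2 hq1.le) (f := g)
    Set.countable_empty (fun z hz => (hd z (by simpa using hz.2)
      (by simpa using hz.1)).continuousAt.continuousWithinAt)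
    (fun z hz => hd z (by simpa using (not_le.1 (by simpa using hz.1.2)).le)
      (by simpa using (by simpa using hz.1.1 : ‖z‖ < q⁻¹).le))
  have hcirc : ∀ R : ℝ, R ≠ 0 → (∮ z in C(0, R), (z - 0)⁻¹ • g z) =
      Complex.I * ∫ θ in (0 : ℝ)..2 * π, g (circleMap 0 R θ) := by
    intro R hR
    rw [circleIntegral, ← intervalIntegral.integral_const_mul]
    refine intervalIntegral.integral_congr fun θ _ => ?_
    have : circleMap 0 R θ ≠ 0 := circleMap_ne_center hR
    simp only [deriv_circleMap, smul_eq_mul, sub_zero]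
    field_simp
  rw [hcirc _ (inv_ne_zero hq0.ne'), hcirc 1 one_ne_zero] at hann
  have hann' := mul_left_cancel₀ Complex.I_ne_zero hann
  have hrefl : ∀ θ : ℝ, g (circleMap 0 q⁻¹ θ) = -g (circleMap 0 1 (2 * π - θ)) := by
    intro θ
    have e : circleMap 0 q⁻¹ θ = (q * circleMap 0 1 (2 * π - θ))⁻¹ := by
      simp only [circleMap, zero_add, Complex.ofReal_one, one_mul, Complex.ofReal_inv, mul_inv]
      rw [← Complex.exp_neg]
      congr 1
      rw [Complex.exp_eq_exp_iff_exists_int]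
      exact ⟨1, by push_cast; ring⟩
    rw [e, hg]
    exact cokernel_reflect hqc hq _ _ _ _ _ (circleMap_ne_center one_ne_zero)
  rw [intervalIntegral.integral_congr fun θ _ => hrefl θ, intervalIntegral.integral_neg,
    intervalIntegral.integral_comp_sub_left (fun θ => g (circleMap 0 1 θ)) (2 * π), sub_self,
    sub_zero] at hann'
  linear_combination (-1 / 2) * hann'

end Integral


/-! ### Rahman's integral up to a constant -/

section Integral

variable {q : ℝ}

theorem norm_circleMap_one (θ : ℝ) : ‖circleMap 0 1 θ‖ = 1 := by simp

theorem circleMap_one_sub (θ : ℝ) : circleMap 0 1 (2 * π - θ) = (circleMap 0 1 θ)⁻¹ := by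
  simp only [circleMap, zero_add, Complex.ofReal_one, one_mul]
  rw [← Complex.exp_neg, Complex.exp_eq_exp_iff_exists_int]
  exact ⟨1, by push_cast; ring⟩

theorem continuous_circleMap_one : Continuous (circleMap 0 1) := continuous_circleMap 0 1

theorem continuous_circleMap_one_inv : Continuous fun θ => (circleMap 0 1 θ)⁻¹ :=
  continuous_circleMap_one.inv₀ fun _ => circleMap_ne_center one_ne_zero

theorem continuous_cokernel (hq0 : 0 < q) (hq1 : q < 1) {t₁ t₂ t₃ t₄ t₅ : ℂ}
    (h₁ : ‖t₁‖ < 1) (h₂ : ‖t₂‖ < 1) (h₃ : ‖t₃‖ < 1) (h₄ : ‖t₄‖ < 1) (h₅ : ‖t₅‖ < 1) :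
    Continuous fun θ => cokernel q t₁ t₂ t₃ t₄ t₅ (circleMap 0 1 θ) :=
  continuous_iff_continuousAt.2 fun θ =>
    (differentiableAt_cokernel hq0 hq1 h₁ h₂ h₃ h₄ h₅ (norm_circleMap_one θ).ge
      ((norm_circleMap_one θ).trans_le ((one_le_inv₀ hq0).2 hq1.le))).continuousAt.comp
      continuous_circleMap_one.continuousAt

theorem continuous_kernel (hq : ‖(q : ℂ)‖ < 1) {t₁ t₂ t₃ t₄ t₅ : ℂ}
    (h₁ : ‖t₁‖ < 1) (h₂ : ‖t₂‖ < 1) (h₃ : ‖t₃‖ < 1) (h₄ : ‖t₄‖ < 1) (h₅ : ‖t₅‖ < 1) :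
    Continuous fun θ => kernel q t₁ t₂ t₃ t₄ t₅ (circleMap 0 1 θ) := by
  have hc := continuous_circleMap_one
  have hi := continuous_circleMap_one_inv
  have hE := (differentiable_pochProd hq t₁ t₂ t₃ t₄ t₅).continuous
  have hP := continuous_qPochInf hq
  unfold kernel
  refine Continuous.div ?_ ((hE.comp hc).mul (hE.comp hi)) fun θ => mul_ne_zero
    (pochProd_ne_zero hq h₁ h₂ h₃ h₄ h₅ (by simp)) (pochProd_ne_zero hq h₁ h₂ h₃ h₄ h₅ (by simp))
  exact ((hP.comp (hc.pow 2)).mul (hP.comp (hi.pow 2))).mul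
    ((hP.comp (hc.const_mul _)).mul (hP.comp (hi.const_mul _)))

/-- The substitution `θ ↦ 2π - θ` inverts `e^{iθ}`, so the second summand contributes the missing
half of the full circle. -/
theorem integral_cokernel_add (hq0 : 0 < q) (hq1 : q < 1) {t₁ t₂ t₃ t₄ t₅ : ℂ}
    (h₁ : ‖t₁‖ < 1) (h₂ : ‖t₂‖ < 1) (h₃ : ‖t₃‖ < 1) (h₄ : ‖t₄‖ < 1) (h₅ : ‖t₅‖ < 1) :
    ∫ θ in (0 : ℝ)..π, (cokernel q t₁ t₂ t₃ t₄ t₅ (circleMap 0 1 θ) +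
      cokernel q t₁ t₂ t₃ t₄ t₅ (circleMap 0 1 θ)⁻¹) = 0 := by
  have hc := continuous_cokernel hq0 hq1 h₁ h₂ h₃ h₄ h₅
  have h := integral_cokernel hq0 hq1 h₁ h₂ h₃ h₄ h₅
  have hc' : Continuous fun θ => cokernel q t₁ t₂ t₃ t₄ t₅ (circleMap 0 1 (2 * π - θ)) :=
    hc.comp (continuous_const.sub continuous_id)
  simp_rw [← circleMap_one_sub]
  rw [intervalIntegral.integral_add (hc.intervalIntegrable _ _) (hc'.intervalIntegrable _ _),
    intervalIntegral.integral_comp_sub_left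
      (fun θ => cokernel q t₁ t₂ t₃ t₄ t₅ (circleMap 0 1 θ)) (2 * π), sub_zero,
    show 2 * π - π = π by ring,
    intervalIntegral.integral_add_adjacent_intervals (hc.intervalIntegrable _ _)
      (hc.intervalIntegrable _ _), h]

/-- Rahman's integral. -/
noncomputable def rahmanIntegral (q t₁ t₂ t₃ t₄ t₅ : ℂ) : ℂ :=
  ∫ θ in (0 : ℝ)..π, kernel q t₁ t₂ t₃ t₄ t₅ (circleMap 0 1 θ)

theorem rahmanIntegral_mul_left (hq0 : 0 < q) (hq1 : q < 1) {t₁ t₂ t₃ t₄ t₅ : ℂ}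
    (h₁ : ‖t₁‖ < 1) (h₂ : ‖t₂‖ < 1) (h₃ : ‖t₃‖ < 1) (h₄ : ‖t₄‖ < 1) (h₅ : ‖t₅‖ < 1) :
    (1 - t₁ * t₃ * t₄ * t₅) * (1 - t₁ * t₂ * t₄ * t₅) * (1 - t₁ * t₂ * t₃ * t₅) *
          (1 - t₁ * t₂ * t₃ * t₄) * rahmanIntegral q (q * t₁) t₂ t₃ t₄ t₅ =
        (1 - t₁ * t₂) * (1 - t₁ * t₃) * (1 - t₁ * t₄) * (1 - t₁ * t₅) *
          rahmanIntegral q t₁ t₂ t₃ t₄ t₅ := by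
  have hq := norm_ofReal_lt_one hq0 hq1
  have h₁' : ‖(q : ℂ) * t₁‖ < 1 := by
    simpa [mul_comm] using norm_mul_pow_lt_one hq h₁ 1
  rw [← sub_eq_zero]
  simp only [rahmanIntegral]
  rw [← intervalIntegral.integral_const_mul, ← intervalIntegral.integral_const_mul,
    ← intervalIntegral.integral_sub
      (((continuous_kernel hq h₁' h₂ h₃ h₄ h₅).const_mul _).intervalIntegrable _ _)
      (((continuous_kernel hq h₁ h₂ h₃ h₄ h₅).const_mul _).intervalIntegrable _ _),
    intervalIntegral.integral_congr fun θ _ =>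
      kernel_mul_left hq h₁ h₂ h₃ h₄ h₅ (norm_circleMap_one θ),
    intervalIntegral.integral_const_mul, integral_cokernel_add hq0 hq1 h₁ h₂ h₃ h₄ h₅, mul_zero]

theorem rahmanIntegral_mul_pow (hq0 : 0 < q) (hq1 : q < 1) {t₁ t₂ t₃ t₄ t₅ : ℂ}
    (h₁ : ‖t₁‖ < 1) (h₂ : ‖t₂‖ < 1) (h₃ : ‖t₃‖ < 1) (h₄ : ‖t₄‖ < 1) (h₅ : ‖t₅‖ < 1) (n : ℕ) :
    qPoch (t₁ * t₃ * t₄ * t₅) q n * qPoch (t₁ * t₂ * t₄ * t₅) q n *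
        qPoch (t₁ * t₂ * t₃ * t₅) q n * qPoch (t₁ * t₂ * t₃ * t₄) q n *
          rahmanIntegral q (t₁ * q ^ n) t₂ t₃ t₄ t₅ =
      qPoch (t₁ * t₂) q n * qPoch (t₁ * t₃) q n * qPoch (t₁ * t₄) q n * qPoch (t₁ * t₅) q n *
          rahmanIntegral q t₁ t₂ t₃ t₄ t₅ := by
  induction n with
  | zero => simp
  | succ n ih =>
    have h := rahmanIntegral_mul_left hq0 hq1
      (norm_mul_pow_lt_one (norm_ofReal_lt_one hq0 hq1) h₁ n) h₂ h₃ h₄ h₅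
    rw [show (q : ℂ) * (t₁ * q ^ n) = t₁ * q ^ (n + 1) by ring] at h
    simp only [qPoch_succ]
    linear_combination (qPoch (t₁ * t₃ * t₄ * t₅) q n * qPoch (t₁ * t₂ * t₄ * t₅) q n *
        qPoch (t₁ * t₂ * t₃ * t₅) q n * qPoch (t₁ * t₂ * t₃ * t₄) q n) * h +
      ((1 - t₁ * t₂ * q ^ n) * (1 - t₁ * t₃ * q ^ n) * (1 - t₁ * t₄ * q ^ n) *
        (1 - t₁ * t₅ * q ^ n)) * ih

theorem exists_norm_inv_qPochInf_le {q : ℂ} (hq : ‖q‖ < 1) {ρ : ℝ} (hρ : ρ < 1) :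
    ∃ M : ℝ, 0 < M ∧ ∀ x : ℂ, ‖x‖ ≤ ρ → ‖(qPochInf x q)⁻¹‖ ≤ M := by
  obtain ⟨M, hM⟩ := (isCompact_closedBall (0 : ℂ) ρ).exists_bound_of_continuousOn
    (f := fun x => (qPochInf x q)⁻¹) ((continuous_qPochInf hq).continuousOn.inv₀ fun x hx =>
      qPochInf_ne_zero_of_norm_lt hq ((by simpa using hx : ‖x‖ ≤ ρ).trans_lt hρ))
  exact ⟨max M 1, by positivity, fun x hx => (hM x (by simpa using hx)).trans (le_max_left _ _)⟩

/-- Uniformity in the parameters serves two limits: sending one parameter to `0`, and integrating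
the Bailey expansion termwise, where `a q^(2j)` varies. -/
theorem exists_norm_kernel_le {q : ℂ} (hq : ‖q‖ < 1) {ρ : ℝ} (hρ : ρ < 1) :
    ∃ M : ℝ, ∀ t₁ t₂ t₃ t₄ t₅ z : ℂ, ‖t₁‖ ≤ ρ → ‖t₂‖ ≤ ρ → ‖t₃‖ ≤ ρ → ‖t₄‖ ≤ ρ → ‖t₅‖ ≤ ρ →
      ‖z‖ = 1 → ‖kernel q t₁ t₂ t₃ t₄ t₅ z‖ ≤ M := by
  obtain ⟨M, hM, H⟩ := exists_norm_qPochInf_le hq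
  obtain ⟨K, hK, HK⟩ := exists_norm_inv_qPochInf_le hq hρ
  refine ⟨M * M * (M * M) * (K * K * K * K * K * (K * K * K * K * K)), ?_⟩
  intro t₁ t₂ t₃ t₄ t₅ z h₁ h₂ h₃ h₄ h₅ hz
  have hz' : ‖z⁻¹‖ = 1 := by rw [norm_inv, hz, inv_one]
  have hA : ‖t₁ * t₂ * t₃ * t₄ * t₅‖ ≤ 1 := by
    simp only [norm_mul]
    have := fun {x : ℂ} (hx : ‖x‖ ≤ ρ) => hx.trans hρ.le
    exact mul_le_one₀ (mul_le_one₀ (mul_le_one₀ (mul_le_one₀ (this h₁) (norm_nonneg _) (this h₂))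
      (norm_nonneg _) (this h₃)) (norm_nonneg _) (this h₄)) (norm_nonneg _) (this h₅)
  have b₁ : ‖z ^ 2‖ ≤ 1 := by rw [norm_pow, hz, one_pow]
  have b₂ : ‖z⁻¹ ^ 2‖ ≤ 1 := by rw [norm_pow, hz', one_pow]
  have b₃ : ‖t₁ * t₂ * t₃ * t₄ * t₅ * z‖ ≤ 1 := by rwa [norm_mul, hz, mul_one]
  have b₄ : ‖t₁ * t₂ * t₃ * t₄ * t₅ * z⁻¹‖ ≤ 1 := by rwa [norm_mul, hz', mul_one]
  have key : ∀ {t w : ℂ}, ‖t‖ ≤ ρ → ‖w‖ = 1 → ‖(qPochInf (t * w) q)⁻¹‖ ≤ K := fun ht hw =>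
    HK _ (by rwa [norm_mul, hw, mul_one])
  rw [kernel, div_eq_mul_inv, pochProd, pochProd]
  simp only [mul_inv, norm_mul]
  gcongr
  all_goals first
    | exact key ‹_› hz
    | exact key ‹_› hz'
    | exact H _ b₁
    | exact H _ b₂
    | exact H _ b₃
    | exact H _ b₄

theorem tendsto_rahmanIntegral (hq0 : 0 < q) (hq1 : q < 1) {t₁ t₂ t₃ t₄ t₅ : ℂ}
    (h₁ : ‖t₁‖ < 1) (h₂ : ‖t₂‖ < 1) (h₃ : ‖t₃‖ < 1) (h₄ : ‖t₄‖ < 1) (h₅ : ‖t₅‖ < 1) :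
    Tendsto (fun n : ℕ => rahmanIntegral q (t₁ * q ^ n) t₂ t₃ t₄ t₅) atTop
      (𝓝 (rahmanIntegral q 0 t₂ t₃ t₄ t₅)) := by
  have hq := norm_ofReal_lt_one hq0 hq1
  have hP := continuous_qPochInf hq
  obtain ⟨ρ, hρ, r₁, r₂, r₃, r₄, r₅⟩ : ∃ ρ < 1, ‖t₁‖ ≤ ρ ∧ ‖t₂‖ ≤ ρ ∧ ‖t₃‖ ≤ ρ ∧ ‖t₄‖ ≤ ρ ∧
      ‖t₅‖ ≤ ρ := by
    refine ⟨max ‖t₁‖ (max ‖t₂‖ (max ‖t₃‖ (max ‖t₄‖ ‖t₅‖))), ?_, ?_⟩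
    · simp only [max_lt_iff]; exact ⟨h₁, h₂, h₃, h₄, h₅⟩
    · simp
  obtain ⟨M, hM⟩ := exists_norm_kernel_le hq hρ
  have hn : ∀ n : ℕ, ‖t₁ * (q : ℂ) ^ n‖ ≤ ‖t₁‖ := fun n => by
    rw [norm_mul, norm_pow]
    exact mul_le_of_le_one_right (norm_nonneg _) (pow_le_one₀ (norm_nonneg _) hq.le)
  refine intervalIntegral.tendsto_integral_filter_of_dominated_convergence (fun _ => M)
    (.of_forall fun n => (continuous_kernel hq ((hn n).trans_lt h₁) h₂ h₃ h₄ h₅).aestronglyMeasurable)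
    (.of_forall fun n => .of_forall fun θ _ => hM _ _ _ _ _ _ ((hn n).trans r₁) r₂ r₃ r₄ r₅
      (norm_circleMap_one θ)) intervalIntegrable_const (.of_forall fun θ _ => ?_)
  have hc : ContinuousAt (fun t => kernel (q : ℂ) t t₂ t₃ t₄ t₅ (circleMap 0 1 θ)) 0 := by
    have h0 : ‖(0 : ℂ)‖ < 1 := by simp
    unfold kernel
    refine ContinuousAt.div ?_ ?_ (mul_ne_zero
      (pochProd_ne_zero hq h0 h₂ h₃ h₄ h₅ (by simp)) (pochProd_ne_zero hq h0 h₂ h₃ h₄ h₅ (by simp)))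
    · exact Continuous.continuousAt (continuous_const.mul
        ((hP.comp (by fun_prop)).mul (hP.comp (by fun_prop))))
    · unfold pochProd
      exact Continuous.continuousAt (((((hP.comp (by fun_prop)).mul continuous_const).mul
        continuous_const).mul continuous_const).mul continuous_const |>.mul
        (((((hP.comp (by fun_prop)).mul continuous_const).mul
        continuous_const).mul continuous_const).mul continuous_const))
  refine hc.tendsto.comp ?_
  simpa using (tendsto_pow_atTop_nhds_zero_of_norm_lt_one hq).const_mul t₁

/-- The limit `n → ∞` of the iterated functional equation `rahmanIntegral_mul_pow`. -/
theorem rahmanIntegral_eq_zero_left (hq0 : 0 < q) (hq1 : q < 1) {t₁ t₂ t₃ t₄ t₅ : ℂ}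
    (h₁ : ‖t₁‖ < 1) (h₂ : ‖t₂‖ < 1) (h₃ : ‖t₃‖ < 1) (h₄ : ‖t₄‖ < 1) (h₅ : ‖t₅‖ < 1) :
    qPochInf (t₁ * t₃ * t₄ * t₅) q * qPochInf (t₁ * t₂ * t₄ * t₅) q *
        qPochInf (t₁ * t₂ * t₃ * t₅) q * qPochInf (t₁ * t₂ * t₃ * t₄) q *
          rahmanIntegral q 0 t₂ t₃ t₄ t₅ =
      qPochInf (t₁ * t₂) q * qPochInf (t₁ * t₃) q * qPochInf (t₁ * t₄) q * qPochInf (t₁ * t₅) q *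
          rahmanIntegral q t₁ t₂ t₃ t₄ t₅ := by
  have hq := norm_ofReal_lt_one hq0 hq1
  have hP := fun a : ℂ => tendsto_qPoch hq a
  refine tendsto_nhds_unique (((((hP _).mul (hP _)).mul (hP _)).mul (hP _)).mul
    (tendsto_rahmanIntegral hq0 hq1 h₁ h₂ h₃ h₄ h₅)) ?_
  simp_rw [rahmanIntegral_mul_pow hq0 hq1 h₁ h₂ h₃ h₄ h₅]
  exact ((((hP _).mul (hP _)).mul (hP _)).mul (hP _)).mul_const _

/-- Rahman's integral divided by its expected value, up to a constant. -/
noncomputable def normalizedIntegral (q t₁ t₂ t₃ t₄ t₅ : ℂ) : ℂ :=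
  rahmanIntegral q t₁ t₂ t₃ t₄ t₅ *
    (qPochInf (t₁ * t₂) q * qPochInf (t₁ * t₃) q * qPochInf (t₁ * t₄) q * qPochInf (t₁ * t₅) q *
      (qPochInf (t₂ * t₃) q * qPochInf (t₂ * t₄) q * qPochInf (t₂ * t₅) q *
      (qPochInf (t₃ * t₄) q * qPochInf (t₃ * t₅) q * qPochInf (t₄ * t₅) q))) /
    (qPochInf (t₁ * t₃ * t₄ * t₅) q * qPochInf (t₁ * t₂ * t₄ * t₅) q *
        qPochInf (t₁ * t₂ * t₃ * t₅) q * qPochInf (t₁ * t₂ * t₃ * t₄) q *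
        qPochInf (t₂ * t₃ * t₄ * t₅) q)

/-- Cyclic symmetry is enough, since it brings each parameter in turn to the first slot, where the
functional equation acts. -/
theorem kernel_rotate (q t₁ t₂ t₃ t₄ t₅ z : ℂ) :
    kernel q t₁ t₂ t₃ t₄ t₅ z = kernel q t₂ t₃ t₄ t₅ t₁ z := by
  simp only [kernel, pochProd]
  rw [show t₁ * t₂ * t₃ * t₄ * t₅ = t₂ * t₃ * t₄ * t₅ * t₁ by ring]
  congr 1; ring

theorem normalizedIntegral_rotate (q t₁ t₂ t₃ t₄ t₅ : ℂ) :
    normalizedIntegral q t₁ t₂ t₃ t₄ t₅ = normalizedIntegral q t₂ t₃ t₄ t₅ t₁ := by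
  simp only [normalizedIntegral, rahmanIntegral, kernel_rotate q t₁]
  rw [show t₁ * t₃ * t₄ * t₅ = t₃ * t₄ * t₅ * t₁ by ring,
    show t₁ * t₂ * t₄ * t₅ = t₂ * t₄ * t₅ * t₁ by ring,
    show t₁ * t₂ * t₃ * t₅ = t₂ * t₃ * t₅ * t₁ by ring,
    show t₁ * t₂ * t₃ * t₄ = t₂ * t₃ * t₄ * t₁ by ring,
    mul_comm t₁ t₂, mul_comm t₁ t₃, mul_comm t₁ t₄, mul_comm t₁ t₅]
  congr 1 <;> ring

theorem norm_mul_lt_one {x y : ℂ} (hx : ‖x‖ < 1) (hy : ‖y‖ < 1) : ‖x * y‖ < 1 := by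
  rw [norm_mul]
  exact mul_lt_one_of_nonneg_of_lt_one_left (norm_nonneg _) hx hy.le

theorem normalizedIntegral_zero_left (hq0 : 0 < q) (hq1 : q < 1) {t₁ t₂ t₃ t₄ t₅ : ℂ}
    (h₁ : ‖t₁‖ < 1) (h₂ : ‖t₂‖ < 1) (h₃ : ‖t₃‖ < 1) (h₄ : ‖t₄‖ < 1) (h₅ : ‖t₅‖ < 1) :
    normalizedIntegral q t₁ t₂ t₃ t₄ t₅ = normalizedIntegral q 0 t₂ t₃ t₄ t₅ := by
  have hq := norm_ofReal_lt_one hq0 hq1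
  have h := rahmanIntegral_eq_zero_left hq0 hq1 h₁ h₂ h₃ h₄ h₅
  have n1 := qPochInf_ne_zero_of_norm_lt hq (norm_mul_lt_one (norm_mul_lt_one (norm_mul_lt_one h₁ h₃) h₄) h₅)
  have n2 := qPochInf_ne_zero_of_norm_lt hq (norm_mul_lt_one (norm_mul_lt_one (norm_mul_lt_one h₁ h₂) h₄) h₅)
  have n3 := qPochInf_ne_zero_of_norm_lt hq (norm_mul_lt_one (norm_mul_lt_one (norm_mul_lt_one h₁ h₂) h₃) h₅)
  have n4 := qPochInf_ne_zero_of_norm_lt hq (norm_mul_lt_one (norm_mul_lt_one (norm_mul_lt_one h₁ h₂) h₃) h₄)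
  have n5 := qPochInf_ne_zero_of_norm_lt hq (norm_mul_lt_one (norm_mul_lt_one (norm_mul_lt_one h₂ h₃) h₄) h₅)
  simp only [normalizedIntegral, zero_mul, qPochInf_zero_left, one_mul]
  rw [div_eq_div_iff (by simp only [mul_ne_zero_iff]; tauto) n5]
  linear_combination (-(qPochInf (t₂ * t₃) q * qPochInf (t₂ * t₄) q * qPochInf (t₂ * t₅) q *
      (qPochInf (t₃ * t₄) q * qPochInf (t₃ * t₅) q * qPochInf (t₄ * t₅) q)) *
      qPochInf (t₂ * t₃ * t₄ * t₅) q) * h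

theorem normalizedIntegral_eq_zero (hq0 : 0 < q) (hq1 : q < 1) {t₁ t₂ t₃ t₄ t₅ : ℂ}
    (h₁ : ‖t₁‖ < 1) (h₂ : ‖t₂‖ < 1) (h₃ : ‖t₃‖ < 1) (h₄ : ‖t₄‖ < 1) (h₅ : ‖t₅‖ < 1) :
    normalizedIntegral q t₁ t₂ t₃ t₄ t₅ = normalizedIntegral q 0 0 0 0 0 := by
  have h0 : ‖(0 : ℂ)‖ < 1 := by simp
  rw [normalizedIntegral_zero_left hq0 hq1 h₁ h₂ h₃ h₄ h₅, normalizedIntegral_rotate,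
    normalizedIntegral_zero_left hq0 hq1 h₂ h₃ h₄ h₅ h0, normalizedIntegral_rotate,
    normalizedIntegral_zero_left hq0 hq1 h₃ h₄ h₅ h0 h0, normalizedIntegral_rotate,
    normalizedIntegral_zero_left hq0 hq1 h₄ h₅ h0 h0 h0, normalizedIntegral_rotate,
    normalizedIntegral_zero_left hq0 hq1 h₅ h0 h0 h0 h0]

end Integral


/-! ### The constant in Rahman's integral -/

section Evaluation

theorem norm_sq_lt_one {q : ℂ} (hq : ‖q‖ < 1) : ‖q ^ 2‖ < 1 := by
  rw [norm_pow]; exact pow_lt_one₀ (norm_nonneg _) hq two_ne_zero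

theorem qPochInf_mul_neg {q : ℂ} (hq : ‖q‖ < 1) (a : ℂ) :
    qPochInf a q * qPochInf (-a) q = qPochInf (a ^ 2) (q ^ 2) :=
  tendsto_nhds_unique ((tendsto_qPoch hq a).mul (tendsto_qPoch hq (-a)))
    ((tendsto_qPoch (norm_sq_lt_one hq) _).congr fun n => (qPoch_mul_neg a q n).symm)

theorem qPochInf_eq_mul_sq {q : ℂ} (hq : ‖q‖ < 1) (a : ℂ) :
    qPochInf a q = qPochInf a (q ^ 2) * qPochInf (a * q) (q ^ 2) := by
  have h := (tendsto_qPoch hq a).comp (tendsto_id.const_mul_atTop' (zero_lt_two (α := ℕ)))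
  refine tendsto_nhds_unique h (((tendsto_qPoch (norm_sq_lt_one hq) a).mul
    (tendsto_qPoch (norm_sq_lt_one hq) (a * q))).congr fun n => (qPoch_two_mul a q n).symm)

/-- Euler's identity `(-q; q)_∞ (q; q²)_∞ = 1`. -/
theorem qPochInf_neg_mul {q : ℂ} (hq : ‖q‖ < 1) :
    qPochInf (-q) q * qPochInf q (q ^ 2) = 1 := by
  have h1 := qPochInf_mul_neg hq q
  rw [qPochInf_eq_mul_sq hq q, ← sq q] at h1
  have h2 := qPochInf_ne_zero_of_norm_lt (norm_sq_lt_one hq) (norm_sq_lt_one hq)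
  exact mul_right_cancel₀ h2 (by linear_combination h1)

/-- The pairs `±s` and `±q` give `(qw²; q²)_∞` and `(q²w²; q²)_∞`, the even and odd factors of the
result. -/
theorem pochProd_special {q s : ℂ} (hq : ‖q‖ < 1) (hs : s ^ 2 = q) (w : ℂ) :
    pochProd q s (-s) q (-q) 0 w = qPochInf (q * w ^ 2) q := by
  rw [pochProd, zero_mul, qPochInf_zero_left, mul_one, neg_mul, neg_mul, qPochInf_mul_neg hq,
    mul_assoc, qPochInf_mul_neg hq, qPochInf_eq_mul_sq hq (q * w ^ 2)]
  congr 2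
  · rw [mul_pow, hs]
  · ring

theorem kernel_special {q s z : ℂ} (hq : ‖q‖ < 1) (hs : s ^ 2 = q) (hz : ‖z‖ = 1) :
    kernel q s (-s) q (-q) 0 z = (1 - z ^ 2) * (1 - z⁻¹ ^ 2) := by
  have hz' : ‖z⁻¹‖ = 1 := by rw [norm_inv, hz, inv_one]
  have key : ∀ w : ℂ, ‖w‖ = 1 → qPochInf (q * w ^ 2) q ≠ 0 := fun w hw =>
    qPochInf_ne_zero_of_norm_lt hq (by rwa [norm_mul, norm_pow, hw, one_pow, mul_one])
  have h1 := key z hz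
  have h2 := key _ hz'
  rw [kernel, pochProd_special hq hs, pochProd_special hq hs, mul_zero, zero_mul, zero_mul,
    qPochInf_zero_left, qPochInf_eq_mul hq (z ^ 2), qPochInf_eq_mul hq (z⁻¹ ^ 2)]
  rw [div_eq_iff (mul_ne_zero h1 h2)]
  ring

theorem integral_special :
    ∫ θ in (0 : ℝ)..π, (1 - circleMap 0 1 θ ^ 2) * (1 - (circleMap 0 1 θ)⁻¹ ^ 2) = 2 * (π : ℂ) := by
  have h : ∀ θ : ℝ, (1 - circleMap 0 1 θ ^ 2) * (1 - (circleMap 0 1 θ)⁻¹ ^ 2) =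
      ((2 - 2 * Real.cos (2 * θ) : ℝ) : ℂ) := by
    intro θ
    have h0 : circleMap 0 1 θ ≠ 0 := circleMap_ne_center one_ne_zero
    have h1 : circleMap 0 1 θ ^ 2 + (circleMap 0 1 θ)⁻¹ ^ 2 = 2 * (Real.cos (2 * θ) : ℂ) := by
      rw [Complex.ofReal_cos, Complex.two_cos]
      simp only [circleMap, zero_add, Complex.ofReal_one, one_mul, ← Complex.exp_neg,
        ← Complex.exp_nat_mul]
      push_cast
      congr 2 <;> ring
    have h2 : circleMap 0 1 θ ^ 2 * (circleMap 0 1 θ)⁻¹ ^ 2 = 1 := by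
      rw [← mul_pow, mul_inv_cancel₀ h0, one_pow]
    push_cast at h1 ⊢
    linear_combination h2 - h1
  rw [intervalIntegral.integral_congr fun θ _ => h θ, intervalIntegral.integral_ofReal]
  have : ∫ θ in (0 : ℝ)..π, (2 - 2 * Real.cos (2 * θ)) = 2 * π := by
    rw [intervalIntegral.integral_sub intervalIntegrable_const
      (Continuous.intervalIntegrable (by fun_prop) _ _)]
    simp [mul_comm _ (2 : ℝ)]
  rw [this]; push_cast; ring

variable {q : ℝ}

/-- Since the normalized integral does not depend on the parameters, it may be computed at `(s, -s,
q, -q, 0)` with `s² = q`, where `kernel_special` applies. -/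
theorem normalizedIntegral_zero (hq0 : 0 < q) (hq1 : q < 1) :
    normalizedIntegral q 0 0 0 0 0 = 2 * π / qPochInf q q := by
  have hq := norm_ofReal_lt_one hq0 hq1
  have hq2 := norm_sq_lt_one hq
  obtain ⟨s, hs, hsn⟩ : ∃ s : ℂ, s ^ 2 = q ∧ ‖s‖ < 1 := by
    refine ⟨(√q : ℝ), by rw [← Complex.ofReal_pow, Real.sq_sqrt hq0.le], ?_⟩
    rw [Complex.norm_real, Real.norm_of_nonneg (Real.sqrt_nonneg _), Real.sqrt_lt' one_pos]
    simpa using hq1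
  rw [← normalizedIntegral_eq_zero hq0 hq1 hsn (by rwa [norm_neg] : ‖-s‖ < 1) hq
    (by rwa [norm_neg] : ‖-(q : ℂ)‖ < 1) (by simp : ‖(0 : ℂ)‖ < 1)]
  simp only [normalizedIntegral, rahmanIntegral]
  rw [intervalIntegral.integral_congr fun θ _ => kernel_special hq hs (norm_circleMap_one θ),
    integral_special]
  simp only [mul_zero, qPochInf_zero_left, mul_one, one_mul]
  -- Each pair `±sq` contributes `((sq)²; q²)_∞ = R`; Euler's identity and parity splitting dispose
  -- of the other products.
  set R := qPochInf ((q : ℂ) ^ 3) ((q : ℂ) ^ 2) with hR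
  have e1 : qPochInf (s * q) q * qPochInf (s * -q) q = R := by
    rw [mul_neg, qPochInf_mul_neg hq, mul_pow, hs, hR]; congr 1; ring
  have e2 : qPochInf (-s * q) q * qPochInf (-s * -q) q = R := by
    rw [mul_comm, neg_mul_neg, ← e1, neg_mul, mul_neg]
  have e3 : s * -s = -q := by rw [mul_neg, ← sq, hs]
  have e4 : (q : ℂ) * -q = -(q * q) := by ring
  have e6 : qPochInf (-(q : ℂ)) q = (1 + q) * qPochInf (-(q * q)) q := by
    rw [qPochInf_eq_mul hq, sub_neg_eq_add, mul_neg]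
  have e7 : qPochInf (q : ℂ) ((q : ℂ) ^ 2) = (1 - q) * R := by
    rw [qPochInf_eq_mul hq2, hR]; congr 2
  have e8 := qPochInf_neg_mul hq
  have e9 := qPochInf_eq_mul_sq hq ((q : ℂ) ^ 3)
  have e10 : qPochInf ((q : ℂ) ^ 2) ((q : ℂ) ^ 2) =
      (1 - (q : ℂ) ^ 2) * qPochInf ((q : ℂ) ^ 3 * q) ((q : ℂ) ^ 2) := by
    rw [qPochInf_eq_mul hq2]; congr 2; ring
  have e11 := qPochInf_mul_neg hq (q : ℂ)
  have n1 := qPochInf_ne_zero_of_norm_lt hq hq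
  have n2 : qPochInf ((q : ℂ) ^ 3) q ≠ 0 := qPochInf_ne_zero_of_norm_lt hq (by
    rw [norm_pow]; exact pow_lt_one₀ (norm_nonneg _) hq three_ne_zero)
  rw [e3, e4, show -(q : ℂ) * q * -q = (q : ℂ) ^ 3 by ring]
  rw [div_eq_div_iff n2 n1, e9]
  rw [e7, e6] at e8
  rw [e10] at e11
  linear_combination (2 * π * (qPochInf (-s * q) q * qPochInf (-s * -q) q *
      qPochInf (-(q : ℂ)) q * qPochInf (-((q : ℂ) * q)) q * qPochInf q q)) * e1 +
    (2 * π * (R * qPochInf (-(q : ℂ)) q * qPochInf (-((q : ℂ) * q)) q * qPochInf q q)) * e2 +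
    (2 * π * (R ^ 2 * qPochInf (-((q : ℂ) * q)) q)) * e11 +
    (2 * π * (R * qPochInf ((q : ℂ) ^ 3 * q) ((q : ℂ) ^ 2))) * e8

/-- Rahman's extension of the Askey–Wilson integral. -/
theorem rahmanIntegral_eq (hq0 : 0 < q) (hq1 : q < 1) {t₁ t₂ t₃ t₄ t₅ : ℂ}
    (h₁ : ‖t₁‖ < 1) (h₂ : ‖t₂‖ < 1) (h₃ : ‖t₃‖ < 1) (h₄ : ‖t₄‖ < 1) (h₅ : ‖t₅‖ < 1) :
    rahmanIntegral q t₁ t₂ t₃ t₄ t₅ =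
      2 * π * (qPochInf (t₁ * t₃ * t₄ * t₅) q * qPochInf (t₁ * t₂ * t₄ * t₅) q *
        qPochInf (t₁ * t₂ * t₃ * t₅) q * qPochInf (t₁ * t₂ * t₃ * t₄) q *
        qPochInf (t₂ * t₃ * t₄ * t₅) q) /
      (qPochInf q q *
        (qPochInf (t₁ * t₂) q * qPochInf (t₁ * t₃) q * qPochInf (t₁ * t₄) q * qPochInf (t₁ * t₅) q *
        (qPochInf (t₂ * t₃) q * qPochInf (t₂ * t₄) q * qPochInf (t₂ * t₅) q *
        (qPochInf (t₃ * t₄) q * qPochInf (t₃ * t₅) q * qPochInf (t₄ * t₅) q)))) := by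
  have hq := norm_ofReal_lt_one hq0 hq1
  have h := (normalizedIntegral_eq_zero hq0 hq1 h₁ h₂ h₃ h₄ h₅).trans
    (normalizedIntegral_zero hq0 hq1)
  have two : ∀ {x y : ℂ}, ‖x‖ < 1 → ‖y‖ < 1 → qPochInf (x * y) q ≠ 0 := fun hx hy =>
    qPochInf_ne_zero_of_norm_lt hq (norm_mul_lt_one hx hy)
  have four : ∀ {x y z w : ℂ}, ‖x‖ < 1 → ‖y‖ < 1 → ‖z‖ < 1 → ‖w‖ < 1 →
      qPochInf (x * y * z * w) q ≠ 0 := fun hx hy hz hw =>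
    qPochInf_ne_zero_of_norm_lt hq (norm_mul_lt_one (norm_mul_lt_one (norm_mul_lt_one hx hy) hz) hw)
  have n0 := qPochInf_ne_zero_of_norm_lt hq hq
  rw [normalizedIntegral, div_eq_div_iff (by
    simp only [mul_ne_zero_iff]
    exact ⟨⟨⟨⟨four h₁ h₃ h₄ h₅, four h₁ h₂ h₄ h₅⟩, four h₁ h₂ h₃ h₅⟩, four h₁ h₂ h₃ h₄⟩,
      four h₂ h₃ h₄ h₅⟩) n0] at h
  rw [eq_div_iff (by
    simp only [mul_ne_zero_iff]
    exact ⟨n0, ⟨⟨⟨two h₁ h₂, two h₁ h₃⟩, two h₁ h₄⟩, two h₁ h₅⟩, ⟨⟨two h₂ h₃, two h₂ h₄⟩,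
      two h₂ h₅⟩, ⟨two h₃ h₄, two h₃ h₅⟩, two h₄ h₅⟩)]
  linear_combination h

end Evaluation


/-! ### Expansion of the integrand and the resulting terms -/

section Expansion

theorem exp_I_mul_eq_circleMap (θ : ℝ) : Complex.exp (Complex.I * θ) = circleMap 0 1 θ := by
  simp [circleMap, mul_comm]

theorem exp_neg_I_mul_eq_circleMap (θ : ℝ) :
    Complex.exp (-(Complex.I * θ)) = (circleMap 0 1 θ)⁻¹ := by
  rw [Complex.exp_neg, exp_I_mul_eq_circleMap]

theorem h_cos_eq {q : ℂ} (hq : ‖q‖ < 1) (θ : ℝ) (a : ℂ) :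
    h (Real.cos θ) a q =
      qPochInf (a * circleMap 0 1 θ) q * qPochInf (a * (circleMap 0 1 θ)⁻¹) q := by
  rw [h_cos θ a hq, exp_I_mul_eq_circleMap, exp_neg_I_mul_eq_circleMap]

theorem h_cos_two_mul {q : ℂ} (hq : ‖q‖ < 1) (θ : ℝ) :
    h (Real.cos (2 * θ)) 1 q =
      qPochInf (circleMap 0 1 θ ^ 2) q * qPochInf ((circleMap 0 1 θ)⁻¹ ^ 2) q := by
  have : circleMap 0 1 (2 * θ) = circleMap 0 1 θ ^ 2 := by
    simp only [circleMap, zero_add, Complex.ofReal_one, one_mul, ← Complex.exp_nat_mul]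
    congr 1; push_cast; ring
  rw [h_cos_eq hq, one_mul, one_mul, this, inv_pow]

theorem hs_cos_eq {q : ℂ} (hq : ‖q‖ < 1) (θ : ℝ) (a b c d r : ℂ) :
    hs (Real.cos θ) [a, b, c, d, r] q =
      pochProd q a b c d r (circleMap 0 1 θ) * pochProd q a b c d r (circleMap 0 1 θ)⁻¹ := by
  simp only [hs, List.map_cons, List.map_nil, List.prod_cons, List.prod_nil, h_cos_eq hq, pochProd]
  ring

theorem pochProd_mul_pow {q : ℂ} (hq : ‖q‖ < 1) (a b c d r w : ℂ) (n : ℕ) :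
    pochProd q a b c d r w = qPoch (a * w) q n * pochProd q (a * q ^ n) b c d r w := by
  simp only [pochProd]
  rw [qPochInf_eq_qPoch_mul hq (a * w) n, mul_right_comm a]
  ring

/-- The finite factorials from Bailey's lemma remove the first `n` factors of the `a`-products in
the denominator, and its infinite products supply Rahman's numerator for `a q^n`. -/
theorem kernel_mul_pow {q : ℂ} (hq : ‖q‖ < 1) {a b c d r w : ℂ} (ha : ‖a‖ < 1) (hw : ‖w‖ = 1)
    (n : ℕ) :
    qPochInf (w ^ 2) q * qPochInf (w⁻¹ ^ 2) q /
        (pochProd q a b c d r w * pochProd q a b c d r w⁻¹) *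
        (qPoch (a * w) q n * qPoch (a * w⁻¹) q n *
          (qPochInf (a * w * (b * c * d * r) * q ^ n) q *
            qPochInf (a * w⁻¹ * (b * c * d * r) * q ^ n) q)) =
      kernel q (a * q ^ n) b c d r w := by
  have key : ∀ v : ℂ, ‖v‖ = 1 → qPoch (a * v) q n ≠ 0 := fun v hv =>
    qPoch_ne_zero_of_norm_lt hq (by rwa [norm_mul, hv, mul_one]) n
  have h1 := key w hw
  have h2 := key w⁻¹ (by rw [norm_inv, hw, inv_one])
  rw [kernel, pochProd_mul_pow hq a b c d r w n, pochProd_mul_pow hq a b c d r w⁻¹ n,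
    show a * w * (b * c * d * r) * q ^ n = a * q ^ n * b * c * d * r * w by ring,
    show a * w⁻¹ * (b * c * d * r) * q ^ n = a * q ^ n * b * c * d * r * w⁻¹ by ring]
  generalize qPoch (a * w) q n = x at *
  generalize qPoch (a * w⁻¹) q n = y at *
  field_simp

variable {q : ℝ} {a b c d r α lam : ℂ}

theorem hasSum_integrand (hq0 : 0 < q) (hq1 : q < 1) (ha : ‖a‖ < 1) (hb : ‖b‖ < 1) (hc : ‖c‖ < 1)
    (hd : ‖d‖ < 1) (hr : ‖r‖ < 1) (hα : (q : ℂ) * α = a ^ 2 * b * c * d * r) (hα1 : α ≠ 1)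
    (hlam0 : lam ≠ 0) (hlam : ∀ k : ℕ, lam * (q : ℂ) ^ k ≠ 1) {μ ν : ℂ} (hμ : μ ^ 2 = lam)
    (hν : ν ^ 2 = q * α) (θ : ℝ) :
    HasSum (fun j => pairAlpha q α lam j * (b * c * d * r) ^ (2 * j) /
        (qPochInf (q * α) q * qPochInf (b * c * d * r) q) *
        kernel q (a * q ^ (2 * j)) b c d r (circleMap 0 1 θ))
      (h (Real.cos (2 * θ)) 1 q / hs (Real.cos θ) [a, b, c, d, r] q *
        phi [a * Complex.exp (Complex.I * θ), a * Complex.exp (-(Complex.I * θ)), μ, -μ]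
          [ν, -ν, lam] q (b * c * d * r)) := by
  have hq := norm_ofReal_lt_one hq0 hq1
  have hqc : (q : ℂ) ≠ 0 := by exact_mod_cast hq0.ne'
  have hz : ‖b * c * d * r‖ < 1 :=
    norm_mul_lt_one (norm_mul_lt_one (norm_mul_lt_one hb hc) hd) hr
  have hα' : ‖(q : ℂ) * α‖ < 1 := by
    rw [hα, show a ^ 2 * b * c * d * r = a * a * (b * c * d * r) by ring]
    exact norm_mul_lt_one (norm_mul_lt_one ha ha) hz
  have hw0 : circleMap 0 1 θ ≠ 0 := circleMap_ne_center one_ne_zero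
  rw [h_cos_two_mul hq, hs_cos_eq hq, exp_I_mul_eq_circleMap, exp_neg_I_mul_eq_circleMap, phi]
  simp_rw [phiTerm_eq_mul_pairBeta hμ hν]
  refine ((tsum_bailey hqc hq hα' hα1 hlam0 hlam hz (by
    rw [hα]; field_simp)).mul_left _).congr_fun fun j => ?_
  rw [← kernel_mul_pow hq ha (norm_circleMap_one θ)]
  ring

theorem qPochInf_mul_pow_eq_div {q : ℂ} (hq : ‖q‖ < 1) {x : ℂ} (hx : ‖x‖ < 1) (n : ℕ) :
    qPochInf (x * q ^ n) q = qPochInf x q / qPoch x q n := by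
  rw [eq_div_iff (qPoch_ne_zero_of_norm_lt hq hx n), qPochInf_eq_qPoch_mul hq x n, mul_comm]

/-- Replacing `a` by `a q^(2n)` divides each infinite product containing `a` by its finite part. Of
the products in Rahman's value, those free of `a` do not change, and `(bcdr; q)_∞` cancels the one
from Bailey's lemma. -/
theorem pairAlpha_mul_rahmanIntegral (hq0 : 0 < q) (hq1 : q < 1) (ha : ‖a‖ < 1) (hb : ‖b‖ < 1)
    (hc : ‖c‖ < 1) (hd : ‖d‖ < 1) (hr : ‖r‖ < 1) (hα : (q : ℂ) * α = a ^ 2 * b * c * d * r)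
    (n : ℕ) :
    pairAlpha q α lam n * (b * c * d * r) ^ (2 * n) /
        (qPochInf (q * α) q * qPochInf (b * c * d * r) q) *
        rahmanIntegral q (a * q ^ (2 * n)) b c d r =
      2 * (π : ℂ) * qPochInfs [a * b * c * d, a * b * c * r, a * b * d * r, a * c * d * r] q /
        qPochInfs [(q : ℂ), a * b, a * c, a * d, a * r, b * c, b * d, b * r, c * d, c * r,
          d * r, a ^ 2 * b * c * d * r] q *
      ((1 - α * (q : ℂ) ^ (4 * n)) * qPochs [α, a * b, a * c, a * d, a * r] q (2 * n) *
          qPochs [(q : ℂ), q * α / lam] ((q : ℂ) ^ 2) n /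
        ((1 - α) * qPochs [(q : ℂ), a * b * c * d, a * b * c * r, a * b * d * r, a * c * d * r] q
            (2 * n) *
          qPochs [q * α, q * lam] ((q : ℂ) ^ 2) n) *
        (b * c * d * r) ^ (2 * n) * lam ^ n * (q : ℂ) ^ (2 * n ^ 2 - n)) := by
  have hq := norm_ofReal_lt_one hq0 hq1
  have hq2 := norm_sq_lt_one hq
  have hz : ‖b * c * d * r‖ < 1 :=
    norm_mul_lt_one (norm_mul_lt_one (norm_mul_lt_one hb hc) hd) hr
  have hα' : ‖(q : ℂ) * α‖ < 1 := by
    rw [hα, show a ^ 2 * b * c * d * r = a * a * (b * c * d * r) by ring]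
    exact norm_mul_lt_one (norm_mul_lt_one ha ha) hz
  have four : ∀ {x y z w : ℂ}, ‖x‖ < 1 → ‖y‖ < 1 → ‖z‖ < 1 → ‖w‖ < 1 → ‖x * y * z * w‖ < 1 :=
    fun hx hy hz hw => norm_mul_lt_one (norm_mul_lt_one (norm_mul_lt_one hx hy) hz) hw
  rw [rahmanIntegral_eq hq0 hq1 (norm_mul_pow_lt_one hq ha _) hb hc hd hr]
  simp only [mul_right_comm a ((q : ℂ) ^ (2 * n)), mul_right_comm _ ((q : ℂ) ^ (2 * n))]
  rw [qPochInf_mul_pow_eq_div hq (four ha hc hd hr), qPochInf_mul_pow_eq_div hq (four ha hb hd hr),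
    qPochInf_mul_pow_eq_div hq (four ha hb hc hr), qPochInf_mul_pow_eq_div hq (four ha hb hc hd),
    qPochInf_mul_pow_eq_div hq (norm_mul_lt_one ha hb),
    qPochInf_mul_pow_eq_div hq (norm_mul_lt_one ha hc),
    qPochInf_mul_pow_eq_div hq (norm_mul_lt_one ha hd),
    qPochInf_mul_pow_eq_div hq (norm_mul_lt_one ha hr)]
  simp only [qPochs, qPochInfs, List.map_cons, List.map_nil, List.prod_cons, List.prod_nil, mul_one,
    pairAlpha, qPoch_two_mul α, qPoch_two_mul (q : ℂ), mul_comm α (q : ℂ), ← sq (q : ℂ), ← hα]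
  have n1 := qPoch_ne_zero_of_norm_lt hq2 hq n
  have n2 := qPoch_ne_zero_of_norm_lt hq2 hα' n
  have n3 := qPochInf_ne_zero_of_norm_lt hq hz
  generalize qPoch (q : ℂ) ((q : ℂ) ^ 2) n = x₁ at *
  generalize qPoch ((q : ℂ) * α) ((q : ℂ) ^ 2) n = x₂ at *
  generalize qPochInf (b * c * d * r) (q : ℂ) = x₃ at *
  -- Splitting `(α; q)_{2n}` and `(q; q)_{2n}` by parity exposes `(qα; q²)_n` and `(q; q²)_n`, which
  -- occur above and below in the target term.
  have r₁ : ∀ A u v w D s t g : ℂ, A * (u * x₂ * v) * (x₁ * w) / (D * (x₁ * s * t) * (x₂ * g)) =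
      A * (u * v) * w / (D * (s * t) * g) := fun A u v w D s t g => by
    rw [show A * (u * x₂ * v) * (x₁ * w) = x₁ * x₂ * (A * (u * v) * w) by ring,
      show D * (x₁ * s * t) * (x₂ * g) = x₁ * x₂ * (D * (s * t) * g) by ring,
      mul_div_mul_left _ _ (mul_ne_zero n1 n2)]
  have r₂ : ∀ A P m E : ℂ, A / (P * x₃) * (m * x₃ / E) = A / P * (m / E) := fun A P m E => by
    rw [div_mul_div_comm, ← mul_assoc, mul_right_comm P, mul_div_mul_right _ _ n3,
      div_mul_div_comm]
  rw [r₁, ← mul_assoc (2 * (π : ℂ)), r₂]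
  generalize (q : ℂ) ^ (2 * n ^ 2 - n) = y₁
  generalize lam ^ n = y₂
  generalize (b * c * d * r) ^ (2 * n) = y₃
  generalize 1 - α * (q : ℂ) ^ (4 * n) = y₄
  generalize 1 - α = y₅
  simp only [div_eq_mul_inv, mul_inv, inv_inv]
  ring

end Expansion

end QBeta

/-- Here `μ` and `ν` stand for `√λ` and `√(qα)`, with either choice of the square roots, and
`α = a² b c d r / q`. The exponent `2 * n ^ 2 - n` is a natural number, no truncation occurs. -/
theorem theorem6p7 (q : ℝ) (hq0 : 0 < q) (hq1 : q < 1)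
    (a b c d r : ℂ) (ha : ‖a‖ < 1) (hb : ‖b‖ < 1) (hc : ‖c‖ < 1) (hd : ‖d‖ < 1) (hr : ‖r‖ < 1)
    (α : ℂ) (hα : α = a ^ 2 * b * c * d * r / q) (hα1 : α ≠ 1)
    (lam : ℂ) (hlam0 : lam ≠ 0) (hlam : ∀ k : ℕ, lam * (q : ℂ) ^ k ≠ 1)
    (μ ν : ℂ) (hμ : μ ^ 2 = lam) (hν : ν ^ 2 = q * α) :
    (∀ θ : ℝ, Summable (QBeta.phiTerm
      [a * Complex.exp (Complex.I * θ), a * Complex.exp (-(Complex.I * θ)), μ, -μ]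
      [ν, -ν, lam] q (b * c * d * r))) ∧
    IntervalIntegrable (fun θ : ℝ =>
      QBeta.h (Real.cos (2 * θ)) 1 q / QBeta.hs (Real.cos θ) [a, b, c, d, r] q *
        QBeta.phi [a * Complex.exp (Complex.I * θ), a * Complex.exp (-(Complex.I * θ)), μ, -μ]
          [ν, -ν, lam] q (b * c * d * r)) MeasureTheory.volume 0 π ∧
    Summable (fun n : ℕ =>
      (1 - α * (q : ℂ) ^ (4 * n)) * QBeta.qPochs [α, a * b, a * c, a * d, a * r] q (2 * n) *
          QBeta.qPochs [(q : ℂ), q * α / lam] ((q : ℂ) ^ 2) n /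
        ((1 - α) *
          QBeta.qPochs [(q : ℂ), a * b * c * d, a * b * c * r, a * b * d * r, a * c * d * r] q
            (2 * n) *
          QBeta.qPochs [q * α, q * lam] ((q : ℂ) ^ 2) n) *
        (b * c * d * r) ^ (2 * n) * lam ^ n * (q : ℂ) ^ (2 * n ^ 2 - n)) ∧
    ∫ θ in (0 : ℝ)..π,
      QBeta.h (Real.cos (2 * θ)) 1 q / QBeta.hs (Real.cos θ) [a, b, c, d, r] q *
        QBeta.phi [a * Complex.exp (Complex.I * θ), a * Complex.exp (-(Complex.I * θ)), μ, -μ]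
          [ν, -ν, lam] q (b * c * d * r) =
      2 * (π : ℂ) *
          QBeta.qPochInfs [a * b * c * d, a * b * c * r, a * b * d * r, a * c * d * r] q /
        QBeta.qPochInfs [(q : ℂ), a * b, a * c, a * d, a * r, b * c, b * d, b * r, c * d, c * r,
          d * r, a ^ 2 * b * c * d * r] q *
      ∑' n : ℕ,
        (1 - α * (q : ℂ) ^ (4 * n)) * QBeta.qPochs [α, a * b, a * c, a * d, a * r] q (2 * n) *
            QBeta.qPochs [(q : ℂ), q * α / lam] ((q : ℂ) ^ 2) n /
          ((1 - α) *
            QBeta.qPochs [(q : ℂ), a * b * c * d, a * b * c * r, a * b * d * r, a * c * d * r] q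
              (2 * n) *
            QBeta.qPochs [q * α, q * lam] ((q : ℂ) ^ 2) n) *
          (b * c * d * r) ^ (2 * n) * lam ^ n * (q : ℂ) ^ (2 * n ^ 2 - n) := by
  have hq := QBeta.norm_ofReal_lt_one hq0 hq1
  have hqc : (q : ℂ) ≠ 0 := by exact_mod_cast hq0.ne'
  have hqα : (q : ℂ) * α = a ^ 2 * b * c * d * r := by rw [hα]; field_simp
  have hz : ‖b * c * d * r‖ < 1 :=
    QBeta.norm_mul_lt_one (QBeta.norm_mul_lt_one (QBeta.norm_mul_lt_one hb hc) hd) hr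
  have hα' : ‖(q : ℂ) * α‖ < 1 := by
    rw [hqα, show a ^ 2 * b * c * d * r = a * a * (b * c * d * r) by ring]
    exact QBeta.norm_mul_lt_one (QBeta.norm_mul_lt_one ha ha) hz
  have hsum := QBeta.hasSum_integrand hq0 hq1 ha hb hc hd hr hqα hα1 hlam0 hlam hμ hν
  set F : ℝ → ℂ := fun θ =>
    QBeta.h (Real.cos (2 * θ)) 1 q / QBeta.hs (Real.cos θ) [a, b, c, d, r] q *
      QBeta.phi [a * Complex.exp (Complex.I * θ), a * Complex.exp (-(Complex.I * θ)), μ, -μ]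
        [ν, -ν, lam] q (b * c * d * r) with hF
  set C : ℕ → ℂ := fun j => QBeta.pairAlpha q α lam j * (b * c * d * r) ^ (2 * j) /
    (QBeta.qPochInf (q * α) q * QBeta.qPochInf (b * c * d * r) q) with hC
  set k : ℕ → ℝ → ℂ := fun j θ =>
    QBeta.kernel q (a * q ^ (2 * j)) b c d r (circleMap 0 1 θ) with hk
  have hFs : ∀ θ, HasSum (fun j => C j * k j θ) (F θ) := hsum
  have haj : ∀ j : ℕ, ‖a * (q : ℂ) ^ (2 * j)‖ < 1 := fun j => QBeta.norm_mul_pow_lt_one hq ha _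
  have hkc : ∀ j, Continuous (k j) := fun j =>
    QBeta.continuous_kernel hq (haj j) hb hc hd hr
  obtain ⟨ρ, hρ, r₁, r₂, r₃, r₄, r₅⟩ : ∃ ρ < 1, ‖a‖ ≤ ρ ∧ ‖b‖ ≤ ρ ∧ ‖c‖ ≤ ρ ∧ ‖d‖ ≤ ρ ∧
      ‖r‖ ≤ ρ := by
    refine ⟨max ‖a‖ (max ‖b‖ (max ‖c‖ (max ‖d‖ ‖r‖))), ?_, ?_⟩
    · simp only [max_lt_iff]; exact ⟨ha, hb, hc, hd, hr⟩
    · simp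
  obtain ⟨M, hM⟩ := QBeta.exists_norm_kernel_le hq hρ
  have hkM : ∀ j θ, ‖k j θ‖ ≤ M := fun j θ => by
    refine hM _ _ _ _ _ _ (le_trans ?_ r₁) r₂ r₃ r₄ r₅ (QBeta.norm_circleMap_one θ)
    rw [norm_mul, norm_pow]
    exact mul_le_of_le_one_right (norm_nonneg _) (pow_le_one₀ (norm_nonneg _) hq.le)
  have hCs : Summable fun j => ‖C j‖ * M := by
    refine Summable.mul_right _ (.of_nonneg_of_le (fun _ => norm_nonneg _) (fun j => ?_)
      ((QBeta.summable_pairAlpha hq hα' hα1 hlam0).norm.mul_right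
        ‖QBeta.qPochInf (q * α) q * QBeta.qPochInf (b * c * d * r) q‖⁻¹))
    simp only [hC]
    rw [norm_div, norm_mul, norm_pow, div_eq_mul_inv]
    gcongr
    exact mul_le_of_le_one_right (norm_nonneg _) (pow_le_one₀ (norm_nonneg _) hz.le)
  have hbound : ∀ j θ, ‖C j * k j θ‖ ≤ ‖C j‖ * M := fun j θ => by
    rw [norm_mul]; exact mul_le_mul_of_nonneg_left (hkM j θ) (norm_nonneg _)
  -- Integrability comes from continuity: the expansion converges uniformly in `θ`.
  have hFc : Continuous F := by
    have := continuous_tsum (fun j => (hkc j).const_mul (C j)) hCs hbound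
    simpa only [fun θ => (hFs θ).tsum_eq] using this
  have hint := intervalIntegral.hasSum_integral_of_dominated_convergence
    (μ := MeasureTheory.volume) (a := 0) (b := π) (fun j _ => ‖C j‖ * M)
    (fun j => ((hkc j).const_mul (C j)).aestronglyMeasurable)
    (fun j => .of_forall fun θ _ => hbound j θ) (.of_forall fun θ _ => hCs)
    intervalIntegrable_const (.of_forall fun θ _ => hFs θ)
  simp_rw [intervalIntegral.integral_const_mul] at hint
  have hterm := fun n => QBeta.pairAlpha_mul_rahmanIntegral (lam := lam) hq0 hq1 ha hb hc hd hr hqα n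
  have hint' := hint.congr_fun fun j => (hterm j).symm
  -- Termwise integration shows that the series times this prefactor converges; a nonzero prefactor
  -- can be divided out to give summability of the series itself.
  have hK : 2 * (π : ℂ) *
      QBeta.qPochInfs [a * b * c * d, a * b * c * r, a * b * d * r, a * c * d * r] q /
        QBeta.qPochInfs [(q : ℂ), a * b, a * c, a * d, a * r, b * c, b * d, b * r, c * d, c * r,
          d * r, a ^ 2 * b * c * d * r] q ≠ 0 := by
    have two : ∀ {x y : ℂ}, ‖x‖ < 1 → ‖y‖ < 1 → QBeta.qPochInf (x * y) q ≠ 0 := fun hx hy =>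
      QBeta.qPochInf_ne_zero_of_norm_lt hq (QBeta.norm_mul_lt_one hx hy)
    have four : ∀ {x y z w : ℂ}, ‖x‖ < 1 → ‖y‖ < 1 → ‖z‖ < 1 → ‖w‖ < 1 →
        QBeta.qPochInf (x * y * z * w) q ≠ 0 := fun hx hy hz hw =>
      two (QBeta.norm_mul_lt_one (QBeta.norm_mul_lt_one hx hy) hz) hw
    simp only [QBeta.qPochInfs, List.map_cons, List.map_nil, List.prod_cons, List.prod_nil,
      mul_one, ← hqα]
    refine div_ne_zero (mul_ne_zero (mul_ne_zero two_ne_zero (by exact_mod_cast Real.pi_ne_zero))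
      ?_) ?_
    · simp only [mul_ne_zero_iff]
      exact ⟨four ha hb hc hd, four ha hb hc hr, four ha hb hd hr, four ha hc hd hr⟩
    · simp only [mul_ne_zero_iff]
      exact ⟨QBeta.qPochInf_ne_zero_of_norm_lt hq hq, two ha hb, two ha hc, two ha hd, two ha hr,
        two hb hc, two hb hd, two hb hr, two hc hd, two hc hr, two hd hr,
        QBeta.qPochInf_ne_zero_of_norm_lt hq hα'⟩
  have hS := (summable_mul_left_iff hK).1 hint'.summable
  refine ⟨fun θ => ?_, hFc.intervalIntegrable _ _, hS, ?_⟩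
  · exact (QBeta.summable_pairBeta hqc hq hα' hα1 hlam0 hlam _ _ hz).congr fun n =>
      (QBeta.phiTerm_eq_mul_pairBeta hμ hν _ _ _ n).symm
  · rw [← tsum_mul_left]
    exact hint'.tsum_eq.symm
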